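/- Let $n\ge 2$ and $d\ge 2$, and let $\mathcal H=(\mathbb C^d)^{\otimes n}$ be the space of $n$ qudits. For a bipartition $p|q$ of the parties $\{1,\dots,n\}$ and a pure state $\psi\in\mathcal H$ put $$\tau_{p|q}(\psi)=2\Big(1-\operatorname{tr}\big[(\operatorname{tr}_p|\psi\rangle\langle\psi|)^2\big]\Big),\qquad \tau_1(\psi)=\frac1{2^{n-1}-1}\sum_{p|q}\tau_{p|q}(\psi),$$ where $\sum_{p|q}$ is over the $2^{n-1}-1$ unordered non-trivial bipartitions. The entangling power of an operator $U$ on $\mathcal H$ is $$\epsilon_1(U)=\big\langle \tau_1\big(U(\psi_1\otimes\cdots\otimes\psi_n)\big)\big\rangle,$$ the average over independent pure states $\psi_i\in\mathbb C^d$ distributed according to the unitarily invariant probability measure on pure states. Let $\tilde\epsilon_1=\frac1{2^{n-1}-1}\sum_{p|q}\tilde\epsilon_{p|q}$ with $$\tilde\epsilon_{p|q}=2-2\Big(\frac d{d+1}\Big)^n\Big[2^n-\sum_{x'|y'}\frac{\min(d_{px'},d_{qy'})-1}{\min(d_{px'},d_{qy'})}\Big],$$ where $x'|y'$ runs over all $2^n$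 ordered bipartitions (including the trivial ones) of the parties of a second copy $\mathcal H'$ of $\mathcal H$, and $d_{px'}=d^{|p|+|x'|}$, $d_{qy'}=d^{|q|+|y'|}$. Then: 1. The mean of $\epsilon_1$ over the unitary group $U(d^n)$ with respect to the normalized Haar measure is $$\langle\epsilon_1\rangle_{U(d^n)}=\frac{2^n(d^n+1)-2(d+1)^n}{(2^{n-1}-1)(d^n+1)}.$$ 2. The mean of $\epsilon_1$ over the real orthogonal group $O(d^n)$ (acting on $\mathcal H$ through real matrices in the product basis) with respect to the normalized Haar measure is $$\langle\epsilon_1\rangle_{O(d^n)}=\frac{\big[2^n(d^n+1)-2(d+1)^n\big]\big[d^n(d+1)^n-2^n\big]}{(2^{n-1}-1)(d^{2n}+d^n-2)(d+1)^n}.$$ 3. Every $U\in U(d^n)$ satisfies $\epsilon_1(U)\le\tilde\epsilon_1$, and $$\tilde\epsilon_1=2-\frac{2d^n}{(d+1)^n}\Bigg[2^n-\frac1{2^{n-1}-1}\sum_{j=0}^n\binom nj\sum_{l=1}^{\lfloor n/2\rfloor}\binom nl\,\frac{d^{\,n-|l-j|}-1}{d^{\,n-|l-j|}\,2^{\delta^l_{n/2}}}\Bigg],$$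 where $\delta^l_{n/2}=1$ if $l=n/2$ and $0$ otherwise. -/

import Mathlib

open MeasureTheory Matrix

noncomputable section

namespace EntanglingPower

/-! ### Haar measure on the unitary and orthogonal groups -/

section Haar

variable {ι 𝕜 : Type*} [Fintype ι] [DecidableEq ι] [RCLike 𝕜]

instance : MeasurableSpace (Matrix.unitaryGroup ι 𝕜) := borel _

instance : BorelSpace (Matrix.unitaryGroup ι 𝕜) := ⟨rfl⟩

instance : CompactSpace (Matrix.unitaryGroup ι 𝕜) := by
  have hK : IsCompact (Set.univ.pi fun _ : ι => Set.univ.pi fun _ : ι =>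
      Metric.closedBall (0 : 𝕜) 1) :=
    isCompact_univ_pi fun _ => isCompact_univ_pi fun _ => isCompact_closedBall 0 1
  have hC : IsClosed ((Matrix.unitaryGroup ι 𝕜 : Submonoid (Matrix ι ι 𝕜)) :
      Set (Matrix ι ι 𝕜)) := by
    have h : ((Matrix.unitaryGroup ι 𝕜 : Submonoid (Matrix ι ι 𝕜)) : Set (Matrix ι ι 𝕜))
        = {A : Matrix ι ι 𝕜 | A * star A = 1} := by
      ext A
      exact Matrix.mem_unitaryGroup_iff
    rw [h]
    exact isClosed_eq (continuous_id.mul continuous_star) continuous_const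
  refine isCompact_iff_compactSpace.mp (IsCompact.of_isClosed_subset hK hC ?_)
  intro A hA i _ j _
  simpa using entry_norm_bound_of_unitary hA i j

/-- The normalized Haar measure on the group of unitary matrices over `ℝ` or `ℂ`: the Haar
measure of total mass one. Over `ℝ` this is the Haar measure on the orthogonal group. -/
def haarUnitary (ι 𝕜 : Type*) [Fintype ι] [DecidableEq ι] [RCLike 𝕜] :
    Measure (Matrix.unitaryGroup ι 𝕜) :=
  Measure.haarMeasure (⊤ : TopologicalSpace.PositiveCompacts (Matrix.unitaryGroup ι 𝕜))

end Haar

/-! ### Pure states of `n` qudits -/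

/-- Labels `(j₁, …, jₙ)` of the product basis of `(ℂ^d)^{⊗ n}`, a space of dimension `d ^ n`.
Vectors of this space are given by their coefficients in that basis. -/
abbrev Index (n d : ℕ) : Type := Fin n → Fin d

/-- Unit vectors of a single qudit. -/
abbrev QuditState (d : ℕ) : Type := Metric.sphere (0 : EuclideanSpace ℂ (Fin d)) 1

/-- The unitarily invariant probability measure on the pure states of one qudit: the normalized
surface measure of the unit sphere of `ℂ^d`. -/
def quditMeasure (d : ℕ) : Measure (QuditState d) :=
  ((volume : Measure (EuclideanSpace ℂ (Fin d))).toSphere Set.univ)⁻¹ •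
    (volume : Measure (EuclideanSpace ℂ (Fin d))).toSphere

/-- The separable pure state `ψ₁ ⊗ ⋯ ⊗ ψₙ`. -/
def productState {n d : ℕ} (ψ : Fin n → QuditState d) : Index n d → ℂ :=
  fun j => ∏ i, (ψ i : EuclideanSpace ℂ (Fin d)) (j i)

/-- The matrix `|ψ⟩⟨ψ|`. -/
def density {n d : ℕ} (ψ : Index n d → ℂ) : Matrix (Index n d) (Index n d) ℂ :=
  Matrix.vecMulVec ψ (star ψ)

/-- The label in the product basis that equals `a` on the parties in `p` and `b` on the others. -/
def glue {n d : ℕ} (p : Finset (Fin n)) (a : {i // i ∈ p} → Fin d) (b : {i // i ∉ p} → Fin d) :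
    Index n d :=
  fun i => if h : i ∈ p then a ⟨i, h⟩ else b ⟨i, h⟩

/-- The partial trace over the parties in `p`. -/
def partialTrace {n d : ℕ} (p : Finset (Fin n)) (ρ : Matrix (Index n d) (Index n d) ℂ) :
    Matrix ({i // i ∉ p} → Fin d) ({i // i ∉ p} → Fin d) ℂ :=
  fun b b' => ∑ a : {i // i ∈ p} → Fin d, ρ (glue p a b) (glue p a b')

/-- The generalized concurrence `τ_{p|q}(ψ) = 2 (1 - tr ((tr_p |ψ⟩⟨ψ|)²))`, `q` being the
complement of `p`. -/
def concurrence {n d : ℕ} (p : Finset (Fin n)) (ψ : Index n d → ℂ) : ℝ :=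
  2 * (1 - (Matrix.trace (partialTrace p (density ψ) ^ 2)).re)

/-! ### Sums over bipartitions -/

/-- The parts `p` of the non-trivial bipartitions `p|q` of the `n` parties. Every unordered
bipartition `{p, q}` occurs twice here, once through `p` and once through `q`. -/
def properParts (n : ℕ) : Finset (Finset (Fin n)) :=
  Finset.univ.filter fun p => p.Nonempty ∧ pᶜ.Nonempty

/-- The average `(2^(n-1) - 1)⁻¹ ∑_{p|q} f(p|q)` over the `2^(n-1) - 1` unordered non-trivial
bipartitions of `n ≥ 2` parties, for an `f` with `f(p|q) = f(q|p)`; the factor `1 / 2`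
compensates for the double counting in `properParts`. -/
def bipartitionMean (n : ℕ) (f : Finset (Fin n) → ℝ) : ℝ :=
  1 / ((2 : ℝ) ^ (n - 1) - 1) * ((1 / 2) * ∑ p ∈ properParts n, f p)

/-- The one-tangle `τ₁(ψ)` of an `n`-party pure state. -/
def oneTangle {n d : ℕ} (ψ : Index n d → ℂ) : ℝ :=
  bipartitionMean n fun p => concurrence p ψ

/-! ### Entangling power -/

/-- The entangling power `ε₁(U)`: the average one-tangle of `U ψ` over the separable pure states
`ψ = ψ₁ ⊗ ⋯ ⊗ ψₙ`, the `ψᵢ` being independent and uniformly distributed. -/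
def entanglingPower {n d : ℕ} (U : Matrix (Index n d) (Index n d) ℂ) : ℝ :=
  ∫ ψ : Fin n → QuditState d, oneTangle (U *ᵥ productState ψ)
    ∂Measure.pi fun _ : Fin n => quditMeasure d

/-- The dimension of the subsystem `p x'` of the doubled space `ℋ ⊗ ℋ'`, which consists of the
parties in `p` from `ℋ` and those in `x` from `ℋ'`. -/
def subsystemDim {n : ℕ} (d : ℕ) (p x : Finset (Fin n)) : ℕ :=
  d ^ p.card * d ^ x.card

/-- The bound for the entangling power on the bipartition `p|q`,
`2 - 2 (d/(d+1))^n [2^n - ∑_{x'|y'} (m - 1)/m]` with `m = min (d_{px'}, d_{qy'})`; the sum is over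
all ordered bipartitions `x'|y'` of `ℋ'`, including the trivial ones. -/
def bipartitionBound {n : ℕ} (d : ℕ) (p : Finset (Fin n)) : ℝ :=
  2 - 2 * (∏ _i : Fin n, (d : ℝ) / (d + 1)) *
    ((2 : ℝ) ^ n - ∑ x : Finset (Fin n),
      ((min (subsystemDim d p x) (subsystemDim d pᶜ xᶜ) : ℕ) - 1 : ℝ) /
        (min (subsystemDim d p x) (subsystemDim d pᶜ xᶜ) : ℕ))

/-- The upper bound `ε̃₁`, the average of the bounds on all bipartitions. -/
def entanglingPowerBound (n d : ℕ) : ℝ :=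
  bipartitionMean n fun p => bipartitionBound d p

/-! ### The summands over bipartitions do not depend on the order of the two parts -/

theorem concurrence_compl {n d : ℕ} (p : Finset (Fin n)) (ψ : Index n d → ℂ) :
    concurrence pᶜ ψ = concurrence p ψ := by
  have key : ∀ p : Finset (Fin n), Matrix.trace (partialTrace p (density ψ) ^ 2)
      = ∑ b : {i // i ∉ p} → Fin d, ∑ b' : {i // i ∉ p} → Fin d,
        ∑ a : {i // i ∈ p} → Fin d, ∑ a' : {i // i ∈ p} → Fin d,
        ψ (glue p a b) * star (ψ (glue p a b')) * (ψ (glue p a' b') * star (ψ (glue p a' b))) := by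
    intro p
    simp [Matrix.trace, pow_two, Matrix.mul_apply, partialTrace, density, Matrix.vecMulVec_apply,
      Finset.sum_mul_sum]
  let e₁ : {i // i ∉ pᶜ} ≃ {i // i ∈ p} := Equiv.subtypeEquivRight (by simp)
  let e₂ : {i // i ∈ pᶜ} ≃ {i // i ∉ p} := Equiv.subtypeEquivRight (by simp)
  have hg : ∀ (a : {i // i ∈ p} → Fin d) (b : {i // i ∉ p} → Fin d),
      glue pᶜ (fun i => b (e₂ i)) (fun i => a (e₁ i)) = glue p a b := by
    intro a b
    ext i
    by_cases h : i ∈ p <;> simp [glue, h] <;> rfl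
  have hE₁ : ∀ f : ({i // i ∉ pᶜ} → Fin d) → ℂ, ∑ b, f b
      = ∑ a : {i // i ∈ p} → Fin d, f (fun i => a (e₁ i)) := fun f =>
    (Equiv.sum_comp (Equiv.arrowCongr e₁.symm (Equiv.refl (Fin d))) f).symm
  have hE₂ : ∀ f : ({i // i ∈ pᶜ} → Fin d) → ℂ, ∑ b, f b
      = ∑ a : {i // i ∉ p} → Fin d, f (fun i => a (e₂ i)) := fun f =>
    (Equiv.sum_comp (Equiv.arrowCongr e₂.symm (Equiv.refl (Fin d))) f).symm
  unfold concurrence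
  rw [key, key]
  simp only [hE₁, hE₂, hg]
  congr 3
  have hs : ∀ (A B : Type) [Fintype A] [Fintype B] (F : A → A → B → B → ℂ),
      ∑ x, ∑ x', ∑ y, ∑ y', F x x' y y' = ∑ y, ∑ y', ∑ x, ∑ x', F x x' y y' := by
    intro A B _ _ F
    calc ∑ x, ∑ x', ∑ y, ∑ y', F x x' y y'
        = ∑ x, ∑ y, ∑ x', ∑ y', F x x' y y' :=
          Finset.sum_congr rfl fun _ _ => Finset.sum_comm
      _ = ∑ y, ∑ x, ∑ x', ∑ y', F x x' y y' := Finset.sum_comm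
      _ = ∑ y, ∑ x, ∑ y', ∑ x', F x x' y y' :=
          Finset.sum_congr rfl fun _ _ => Finset.sum_congr rfl fun _ _ => Finset.sum_comm
      _ = ∑ y, ∑ y', ∑ x, ∑ x', F x x' y y' :=
          Finset.sum_congr rfl fun _ _ => Finset.sum_comm
  rw [hs]
  refine Finset.sum_congr rfl fun b _ => Finset.sum_congr rfl fun b' _ =>
    Finset.sum_congr rfl fun a _ => Finset.sum_congr rfl fun a' _ => ?_
  ring

theorem bipartitionBound_compl {n : ℕ} (d : ℕ) (p : Finset (Fin n)) :
    bipartitionBound d pᶜ = bipartitionBound d p := by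
  unfold bipartitionBound
  congr 3
  refine Fintype.sum_equiv (compl_involutive (α := Finset (Fin n))).toPerm _ _ fun x => ?_
  simp [min_comm]

end EntanglingPower

end

/-! The concurrence is an affine function of the purity of the reduced state, and the purity of `v`
is a linear contraction of the tensor `v_a v_b v̄_c v̄_e`. Every average in the theorem therefore
reduces to a tensor of fourth moments `𝔼[v_a v_b v̄_c v̄_e]`, and symmetry determines these tensors.

Means over the groups. By Fubini the group average may be taken first, for a fixed product state
`ψ`. Left invariance of Haar measure makes the moment tensor of `Uψ` invariant under the group. An
orthogonally invariant tensor that is symmetric in its first two slots is `X δ_ab δ_ce + Y (δ_ac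
δ_be + δ_ae δ_bc)` (`IsOrthogonalInvariant.exists_eq`); unitary invariance forces `X = 0`. The
remaining coefficients follow from two contractions: one is the norm of `ψ`, the other is `|∑
ψ_a²|²`, which real orthogonal matrices preserve. With `D = d^n`, the mean purity over the unitary
group is `(d^|p| + d^(n-|p|)) / (D + 1)`. Over the orthogonal group it is affine in `|∑ ψ_a²|²`,
whose mean over product states is `(2/(d+1))^n`. The binomial theorem sums the result over the
bipartitions.

Upper bound. The same argument for a single qudit, followed by expansion of a product over the
parties, writes the moments of a random product state as a sum over subsets `x` of the parties.
Hence the mean purity produced by `U` is `(d(d+1))^(-n)` times the sum over `x` of the purity of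
`U`, viewed as a vector of the doubled space cut along `px'|qy'` (`meanPurity_eq`). This vector has
squared norm `D`, so Cauchy–Schwarz bounds each purity below by `D²` over the smaller of the two
dimensions (`sq_le_operatorPurity`). The closed form of the bound only counts subsets by cardinality
and uses the symmetry `p ↔ q`. -/

noncomputable section

namespace EntanglingPower

/-! ### Isotropic tensors of rank four -/

section Isotropic

variable {ι : Type*} [Fintype ι] [DecidableEq ι]

/-- The action of the matrix `A ⊗ A ⊗ Ā ⊗ Ā` on tensors of rank four. -/
def tensorAct (A : Matrix ι ι ℂ) (M : ι → ι → ι → ι → ℂ) (a b c e : ι) : ℂ :=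
  ∑ a', A a a' * ∑ b', A b b' * ∑ c', star (A c c') * ∑ e', star (A e e') * M a' b' c' e'

/-- The reflection `(x, y) ↦ (c x + s y, s x - c y)` in the plane of the coordinates `i`, `j`. -/
def planarReflection (c s : ℝ) (i j : ι) : Matrix ι ι ℝ :=
  Matrix.of fun k l =>
    if k = i then (if l = i then c else 0) + (if l = j then s else 0)
    else if k = j then (if l = i then s else 0) + (if l = j then -c else 0)
    else if l = k then 1 else 0

/-- The homomorphism `φ` allows one computation to serve twice: over `ℝ` to verify orthogonality,
and over `ℂ` to act on tensors. -/
theorem planarReflection_sum_ringHom {K : Type*} [CommRing K] (φ : ℝ →+* K) (c s : ℝ) (i j k : ι)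
    (F : ι → K) :
    ∑ l, φ (planarReflection c s i j k l) * F l =
      if k = i then φ c * F i + φ s * F j
      else if k = j then φ s * F i - φ c * F j else F k := by
  by_cases hi : k = i
  · have h : ∀ l, planarReflection c s i j k l = (if l = i then c else 0) +
        (if l = j then s else 0) := fun l => by
      simp only [planarReflection, Matrix.of_apply, if_pos hi]
    simp only [h, map_add, apply_ite φ, map_zero, add_mul, ite_mul, zero_mul,
      Finset.sum_add_distrib, Finset.sum_ite_eq', Finset.mem_univ, if_true, if_pos hi]
  · by_cases hj : k = j
    · have h : ∀ l, planarReflection c s i j k l = (if l = i then s else 0) +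
          (if l = j then -c else 0) := fun l => by
        simp only [planarReflection, Matrix.of_apply, if_neg hi, if_pos hj]
      simp only [h, map_add, apply_ite φ, map_zero, map_neg, add_mul, ite_mul, zero_mul, neg_mul,
        Finset.sum_add_distrib, Finset.sum_ite_eq', Finset.mem_univ, if_true, if_neg hi, if_pos hj,
        sub_eq_add_neg]
    · have h : ∀ l, planarReflection c s i j k l = if l = k then 1 else 0 := fun l => by
        simp only [planarReflection, Matrix.of_apply, if_neg hi, if_neg hj]
      simp only [h, apply_ite φ, map_zero, map_one, ite_mul, zero_mul, one_mul,
        Finset.sum_ite_eq', Finset.mem_univ, if_true, if_neg hi, if_neg hj]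

theorem planarReflection_sum (c s : ℝ) (i j k : ι) (F : ι → ℂ) :
    ∑ l, (planarReflection c s i j k l : ℂ) * F l =
      if k = i then c * F i + s * F j else if k = j then s * F i - c * F j else F k :=
  planarReflection_sum_ringHom Complex.ofRealHom c s i j k F

theorem planarReflection_mem {c s : ℝ} (h : c ^ 2 + s ^ 2 = 1) {i j : ι} (hij : i ≠ j) :
    planarReflection c s i j ∈ Matrix.orthogonalGroup ι ℝ := by
  rw [Matrix.mem_orthogonalGroup_iff]
  have hT : (planarReflection c s i j)ᵀ = planarReflection c s i j := by
    ext k l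
    simp only [planarReflection, Matrix.transpose_apply, Matrix.of_apply]
    grind
  rw [hT]
  ext k l
  rw [Matrix.mul_apply]
  have h2 := planarReflection_sum_ringHom (RingHom.id ℝ) c s i j k
    fun m => planarReflection c s i j m l
  simp only [RingHom.id_apply] at h2
  rw [h2]
  simp only [planarReflection, Matrix.of_apply, Matrix.one_apply]
  grind

/-- Invariance of a tensor under the orthogonal group. -/
def IsOrthogonalInvariant (M : ι → ι → ι → ι → ℂ) : Prop :=
  ∀ O ∈ Matrix.orthogonalGroup ι ℝ, tensorAct (O.map Complex.ofReal) M = M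

/-- Invariance of a tensor under the unitary group. -/
def IsUnitaryInvariant (M : ι → ι → ι → ι → ℂ) : Prop :=
  ∀ U ∈ Matrix.unitaryGroup ι ℂ, tensorAct U M = M

theorem map_ofReal_mem_unitaryGroup {O : Matrix ι ι ℝ} (hO : O ∈ Matrix.orthogonalGroup ι ℝ) :
    O.map Complex.ofReal ∈ Matrix.unitaryGroup ι ℂ := by
  rw [Matrix.mem_unitaryGroup_iff]
  rw [Matrix.mem_orthogonalGroup_iff] at hO
  have h := congrArg (fun B : Matrix ι ι ℝ => B.map Complex.ofRealHom) hO
  simp only [Matrix.map_mul] at h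
  rw [Matrix.map_one _ (map_zero _) (map_one _)] at h
  convert h using 2 <;> ext a b <;> simp [Matrix.star_apply]

theorem IsUnitaryInvariant.isOrthogonalInvariant {M : ι → ι → ι → ι → ℂ}
    (h : IsUnitaryInvariant M) : IsOrthogonalInvariant M :=
  fun _ hO => h _ (map_ofReal_mem_unitaryGroup hO)

theorem IsOrthogonalInvariant.planar {M : ι → ι → ι → ι → ℂ} (h : IsOrthogonalInvariant M)
    {c s : ℝ} (hcs : c ^ 2 + s ^ 2 = 1) {i j : ι} (hij : i ≠ j) (k₁ k₂ k₃ k₄ : ι) :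
    ∑ a', (planarReflection c s i j k₁ a' : ℂ) * ∑ b', (planarReflection c s i j k₂ b' : ℂ) *
      ∑ c', (planarReflection c s i j k₃ c' : ℂ) * ∑ e', (planarReflection c s i j k₄ e' : ℂ) *
        M a' b' c' e' = M k₁ k₂ k₃ k₄ := by
  have h1 := congrFun (congrFun (congrFun (congrFun (h _ (planarReflection_mem hcs hij)) k₁) k₂)
    k₃) k₄
  simpa [tensorAct] using h1

/-- The reflection with `c = 0`, `s = 1` is the permutation matrix of the transposition of `i` and
`j`. -/
theorem IsOrthogonalInvariant.swap {M : ι → ι → ι → ι → ℂ} (h : IsOrthogonalInvariant M)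
    (i j a b c e : ι) :
    M (Equiv.swap i j a) (Equiv.swap i j b) (Equiv.swap i j c) (Equiv.swap i j e) = M a b c e := by
  rcases eq_or_ne i j with rfl | hij
  · simp
  have key : ∀ (k : ι) (F : ι → ℂ),
      ∑ l, (planarReflection 0 1 i j k l : ℂ) * F l = F (Equiv.swap i j k) := by
    intro k F
    rw [planarReflection_sum, Equiv.swap_apply_def]
    split_ifs <;> simp
  have h1 := h.planar (c := 0) (s := 1) (by norm_num) hij a b c e
  simpa only [key] using h1

/-- The reflection with `c = 1`, `s = 0` changes the sign of coordinate `j` only, so an entry in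
which some label occurs an odd number of times equals its own negative. If no pairing of the four
labels holds, such a label exists. -/
theorem IsOrthogonalInvariant.eq_zero {M : ι → ι → ι → ι → ℂ} (h : IsOrthogonalInvariant M)
    [Nontrivial ι] {a b c e : ι} (h1 : ¬(a = b ∧ c = e)) (h2 : ¬(a = c ∧ b = e))
    (h3 : ¬(a = e ∧ b = c)) : M a b c e = 0 := by
  have key : ∀ (j k : ι) (F : ι → ℂ), ∀ i, i ≠ j →
      ∑ l, (planarReflection 1 0 i j k l : ℂ) * F l = (if k = j then -1 else 1) * F k := by
    intro j k F i hij
    rw [planarReflection_sum]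
    split_ifs <;> simp_all
  have flip : ∀ j : ι, (if a = j then -1 else 1) * ((if b = j then -1 else 1) *
      ((if c = j then -1 else 1) * ((if e = j then -1 else 1) * M a b c e))) = M a b c e := by
    intro j
    obtain ⟨i, hij⟩ := exists_ne j
    have h1 := h.planar (c := 1) (s := 0) (by norm_num) hij a b c e
    simpa only [key j _ _ i hij] using h1
  have ha := flip a
  have hb := flip b
  have hc := flip c
  have he := flip e
  grind

-- Transpositions generate a group that is transitive on ordered pairs of distinct labels: one
-- transposition carries `a` to `b`, a second one fixes `b` and carries the image of `c` to `e`.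
omit [Fintype ι] in
theorem apply_eq_of_swap_invariant {α : Type*} {F : ι → ι → α}
    (hF : ∀ i j a c, F (Equiv.swap i j a) (Equiv.swap i j c) = F a c)
    {a c b e : ι} (hac : a ≠ c) (hbe : b ≠ e) : F a c = F b e := by
  rw [← hF a b a c, Equiv.swap_apply_left, ← hF (Equiv.swap a b c) e b (Equiv.swap a b c),
    Equiv.swap_apply_left, Equiv.swap_apply_of_ne_of_ne _ hbe]
  intro h
  have := congrArg (Equiv.swap a b) h
  simp at this
  exact hac this

/-- A reflection mixing both coordinates ties the entry with four equal labels to the entries with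
two pairs; sign changes and transpositions alone cannot. Any `c`, `s` with `cs ≠ 0` would do, and
`3/5`, `4/5` keeps the arithmetic rational. -/
theorem IsOrthogonalInvariant.diag {M : ι → ι → ι → ι → ℂ} (h : IsOrthogonalInvariant M)
    [Nontrivial ι] {a j : ι} (haj : a ≠ j) :
    M a a a a = M a a j j + M a j a j + M a j j a := by
  have h1 := h.planar (c := 3 / 5) (s := 4 / 5) (by norm_num) haj a a a a
  simp only [planarReflection_sum, if_true] at h1
  have z : ∀ {a b c e : ι}, ¬(a = b ∧ c = e) → ¬(a = c ∧ b = e) → ¬(a = e ∧ b = c) →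
    M a b c e = 0 := h.eq_zero
  have hja := haj.symm
  have s1 := h.swap a j a a a a
  have s2 := h.swap a j a a j j
  have s3 := h.swap a j a j a j
  have s4 := h.swap a j a j j a
  simp only [Equiv.swap_apply_left, Equiv.swap_apply_right] at s1 s2 s3 s4
  rw [z (a := a) (b := a) (c := a) (e := j) (by simp [haj]) (by simp [haj]) (by simp [haj]),
    z (a := a) (b := a) (c := j) (e := a) (by simp [hja]) (by simp [haj]) (by simp [haj]),
    z (a := a) (b := j) (c := a) (e := a) (by simp [haj]) (by simp [hja]) (by simp [hja]),
    z (a := j) (b := a) (c := a) (e := a) (by simp [hja]) (by simp [hja]) (by simp [hja]),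
    z (a := a) (b := j) (c := j) (e := j) (by simp [haj]) (by simp [haj]) (by simp [haj]),
    z (a := j) (b := a) (c := j) (e := j) (by simp [hja]) (by simp [haj]) (by simp [haj]),
    z (a := j) (b := j) (c := a) (e := j) (by simp [haj]) (by simp [hja]) (by simp [hja]),
    z (a := j) (b := j) (c := j) (e := a) (by simp [hja]) (by simp [hja]) (by simp [hja]),
    s1, s2, s3, s4] at h1
  push_cast at h1
  -- The constant comes from `1 - c⁴ - s⁴ = 2c²s² = 288/625`.
  linear_combination (-625 / 288 : ℂ) * h1

/-- Orthogonally invariant tensors of rank four are combinations of the three pairings. -/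
theorem IsOrthogonalInvariant.exists_eq {M : ι → ι → ι → ι → ℂ} (h : IsOrthogonalInvariant M)
    [Nontrivial ι] (hs : ∀ a b c e, M a b c e = M b a c e) :
    ∃ X Y : ℂ, ∀ a b c e, M a b c e = X * (if a = b ∧ c = e then 1 else 0) +
      Y * ((if a = c ∧ b = e then 1 else 0) + (if a = e ∧ b = c then 1 else 0)) := by
  obtain ⟨i, j, hij⟩ := exists_pair_ne ι
  have hX : ∀ a c, a ≠ c → M a a c c = M i i j j := fun a c hac =>
    apply_eq_of_swap_invariant (F := fun a c => M a a c c) (fun _ _ _ _ => h.swap ..) hac hij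
  have hY : ∀ a c, a ≠ c → M a c a c = M i j i j := fun a c hac =>
    apply_eq_of_swap_invariant (F := fun a c => M a c a c) (fun _ _ _ _ => h.swap ..) hac hij
  refine ⟨M i i j j, M i j i j, fun a b c e => ?_⟩
  by_cases h1 : a = b ∧ c = e
  · obtain ⟨rfl, rfl⟩ := h1
    rcases eq_or_ne a c with rfl | hac
    · obtain ⟨k, hk⟩ := exists_ne a
      rw [h.diag hk.symm, hX a k hk.symm, hY a k hk.symm, hs a k k a, hY k a hk]
      simp
      ring
    · simp [hac, hX]
  · by_cases h2 : a = c ∧ b = e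
    · obtain ⟨rfl, rfl⟩ := h2
      have hab : a ≠ b := fun hab => h1 ⟨hab, hab⟩
      simp [hab, hY]
    · by_cases h3 : a = e ∧ b = c
      · obtain ⟨rfl, rfl⟩ := h3
        have hab : a ≠ b := fun hab => h1 ⟨hab, hab.symm⟩
        simp [hab, hs a b b a, hY b a hab.symm]
      · simp [h1, h2, h3, h.eq_zero h1 h2 h3]

/-- The phase `i` on a single coordinate is unitary and multiplies the entry `M i i j j = X` by `i²
= -1`, so the pairing of the two unconjugated slots drops out. -/
theorem IsUnitaryInvariant.exists_eq {M : ι → ι → ι → ι → ℂ} (h : IsUnitaryInvariant M)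
    [Nontrivial ι] (hs : ∀ a b c e, M a b c e = M b a c e) :
    ∃ Y : ℂ, ∀ a b c e, M a b c e =
      Y * ((if a = c ∧ b = e then 1 else 0) + (if a = e ∧ b = c then 1 else 0)) := by
  obtain ⟨X, Y, hM⟩ := h.isOrthogonalInvariant.exists_eq hs
  obtain ⟨i, j, hij⟩ := exists_pair_ne ι
  have hU : Matrix.diagonal (fun k => if k = i then Complex.I else 1) ∈
      Matrix.unitaryGroup ι ℂ := by
    rw [Matrix.mem_unitaryGroup_iff, Matrix.star_eq_conjTranspose, Matrix.diagonal_conjTranspose,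
      Matrix.diagonal_mul_diagonal, ← Matrix.diagonal_one]
    congr 1
    ext k
    simp only [Pi.star_apply]
    split_ifs <;> simp
  have h1 := congrFun (congrFun (congrFun (congrFun (h _ hU) i) i) j) j
  have key : ∀ (u : ι → ℂ) (k : ι) (F : ι → ℂ),
      ∑ l, Matrix.diagonal u k l * F l = u k * F k := fun u k F => by
    simp [Matrix.diagonal_apply]
  have key' : ∀ (u : ι → ℂ) (k : ι) (F : ι → ℂ),
      ∑ l, star (Matrix.diagonal u k l) * F l = star (u k) * F k := fun u k F => by
    simp [Matrix.diagonal_apply, apply_ite]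
  simp only [tensorAct, key, key', hM, hij, hij.symm, if_true, if_false, star_one, one_mul,
    and_self, mul_one, add_zero, mul_zero] at h1
  rw [← mul_assoc, Complex.I_mul_I] at h1
  have hX : X = 0 := by linear_combination (-1 / 2 : ℂ) * h1
  exact ⟨Y, fun a b c e => by rw [hM, hX]; ring⟩

end Isotropic

/-! ### Moments of random vectors -/

section Moments

variable {ι Ω : Type*} [MeasurableSpace Ω]

/-- The moments `𝔼[v_a v_b v̄_c v̄_e]` of a random vector. -/
def moment (μ : Measure Ω) (v : Ω → ι → ℂ) (a b c e : ι) : ℂ :=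
  ∫ ω, v ω a * (v ω b * (star (v ω c) * star (v ω e))) ∂μ

theorem moment_swap (μ : Measure Ω) (v : Ω → ι → ℂ) (a b c e : ι) :
    moment μ v a b c e = moment μ v b a c e := by
  unfold moment
  congr 1 with ω
  ring

variable [TopologicalSpace Ω] [CompactSpace Ω] [OpensMeasurableSpace Ω]
  {μ : Measure Ω} [IsFiniteMeasure μ]

theorem integrable_of_continuous {E : Type*} [NormedAddCommGroup E] {f : Ω → E}
    (hf : Continuous f) : Integrable f μ :=
  hf.integrable_of_hasCompactSupport (HasCompactSupport.of_compactSpace f)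

variable [Fintype ι]

/-- Invariance of a distribution thereby becomes invariance of its moment tensor. The integral is
expanded one slot at a time, with `key` as linearity in the slot in front. -/
theorem moment_mulVec {v : Ω → ι → ℂ} (hv : ∀ a, Continuous fun ω => v ω a)
    (A : Matrix ι ι ℂ) : moment μ (fun ω => A *ᵥ v ω) = tensorAct A (moment μ v) := by
  have key : ∀ (w : ι → ℂ) (u : ι → Ω → ℂ) (F : Ω → ℂ), (∀ i, Continuous (u i)) → Continuous F →
      ∫ ω, (∑ i, w i * u i ω) * F ω ∂μ = ∑ i, w i * ∫ ω, u i ω * F ω ∂μ := by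
    intro w u F hu hF
    simp only [Finset.sum_mul, mul_assoc]
    rw [integral_finsetSum]
    · simp only [integral_const_mul]
    · intro i _
      have := hu i
      exact integrable_of_continuous (by fun_prop)
  have hs : ∀ (c : ι) (ω : Ω), star ((A *ᵥ v ω) c) = ∑ i, star (A c i) * star (v ω i) := by
    intro c ω
    simp [Matrix.mulVec, dotProduct]
  have hm : ∀ (c : ι) (ω : Ω), (A *ᵥ v ω) c = ∑ i, A c i * v ω i := fun _ _ => rfl
  funext a b c e
  unfold moment tensorAct
  simp only [hs]
  simp only [hm]
  rw [key (A a) (fun i ω => v ω i) _ hv (by fun_prop)]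
  refine Finset.sum_congr rfl fun a' _ => ?_
  congr 1
  simp only [mul_left_comm (v _ a')]
  rw [key (A b) (fun i ω => v ω i) _ hv (by fun_prop)]
  refine Finset.sum_congr rfl fun b' _ => ?_
  congr 1
  simp only [mul_left_comm (v _ b')]
  rw [key (fun i => star (A c i)) (fun i ω => star (v ω i)) _ (by fun_prop) (by fun_prop)]
  refine Finset.sum_congr rfl fun c' _ => ?_
  congr 1
  have := key (fun i => star (A e i)) (fun i ω => star (v ω i))
    (fun ω => v ω a' * (v ω b' * star (v ω c'))) (by fun_prop) (by fun_prop)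
  convert this using 3
  · ring
  · congr 2
    ext
    ring

/-- One of the two contractions, with `sum_moment_diag`, that determine the coefficients of an
invariant moment tensor. -/
theorem sum_moment_trace {v : Ω → ι → ℂ} (hv : ∀ a, Continuous fun ω => v ω a) :
    ∑ a, ∑ b, moment μ v a b a b = ∫ ω, (((∑ a, ‖v ω a‖ ^ 2 : ℝ) ^ 2 : ℝ) : ℂ) ∂μ := by
  unfold moment
  have : ∀ ω, (((∑ a, ‖v ω a‖ ^ 2 : ℝ) ^ 2 : ℝ) : ℂ) =
      ∑ a, ∑ b, v ω a * (v ω b * (star (v ω a) * star (v ω b))) := by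
    intro ω
    push_cast
    rw [pow_two, Finset.sum_mul_sum]
    refine Finset.sum_congr rfl fun a _ => Finset.sum_congr rfl fun b _ => ?_
    rw [← Complex.mul_conj', ← Complex.mul_conj']
    simp only [starRingEnd_apply]
    ring
  simp only [this]
  rw [integral_finsetSum]
  · refine Finset.sum_congr rfl fun a _ => ?_
    rw [integral_finsetSum]
    exact fun b _ => integrable_of_continuous (by fun_prop)
  · exact fun a _ => integrable_of_continuous (by fun_prop)

theorem sum_moment_diag {v : Ω → ι → ℂ} (hv : ∀ a, Continuous fun ω => v ω a) :
    ∑ a, ∑ c, moment μ v a a c c = ∫ ω, (((‖∑ a, v ω a ^ 2‖ ^ 2 : ℝ)) : ℂ) ∂μ := by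
  unfold moment
  have : ∀ ω, ((‖∑ a, v ω a ^ 2‖ ^ 2 : ℝ) : ℂ) =
      ∑ a, ∑ c, v ω a * (v ω a * (star (v ω c) * star (v ω c))) := by
    intro ω
    push_cast
    rw [← Complex.mul_conj', map_sum, Finset.sum_mul_sum]
    refine Finset.sum_congr rfl fun a _ => Finset.sum_congr rfl fun b _ => ?_
    simp only [map_pow, starRingEnd_apply]
    ring
  simp only [this]
  rw [integral_finsetSum]
  · refine Finset.sum_congr rfl fun a _ => ?_
    rw [integral_finsetSum]
    exact fun b _ => integrable_of_continuous (by fun_prop)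
  · exact fun a _ => integrable_of_continuous (by fun_prop)

end Moments

/-! ### Purity -/

section Purity

variable {n d : ℕ}

/-- The purity `tr ((tr_p |v⟩⟨v|)²)`. -/
def purity (p : Finset (Fin n)) (v : Index n d → ℂ) : ℂ :=
  ∑ j, ∑ k, v j * (v k * (star (v (p.piecewise j k)) * star (v (p.piecewise k j))))

/-- The contraction of a tensor of rank four that computes the purity. -/
def contract (p : Finset (Fin n)) (M : Index n d → Index n d → Index n d → Index n d → ℂ) : ℂ :=
  ∑ j, ∑ k, M j k (p.piecewise j k) (p.piecewise k j)

/-- Labels of the product basis as pairs of labels of the parties in `p` and of the others. -/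
def glueEquiv (d : ℕ) (p : Finset (Fin n)) :
    ({i // i ∈ p} → Fin d) × ({i // i ∉ p} → Fin d) ≃ Index n d where
  toFun x := glue p x.1 x.2
  invFun j := (fun i => j i, fun i => j i)
  left_inv x := by
    ext i
    · simp [glue, i.2]
    · simp [glue, i.2]
  right_inv j := by
    ext i
    simp [glue]

theorem sum_eq_sum_glue {E : Type*} [AddCommMonoid E] (p : Finset (Fin n)) (F : Index n d → E) :
    ∑ j, F j = ∑ a, ∑ b, F (glue p a b) := by
  rw [← (glueEquiv d p).sum_comp, Fintype.sum_prod_type]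
  rfl

theorem piecewise_glue (p : Finset (Fin n)) (a a' : {i // i ∈ p} → Fin d)
    (b b' : {i // i ∉ p} → Fin d) : p.piecewise (glue p a b) (glue p a' b') = glue p a b' := by
  ext i
  by_cases h : i ∈ p <;> simp [glue, h]

theorem sum_piecewise {E : Type*} [AddCommMonoid E] (p : Finset (Fin n))
    (F : Index n d → Index n d → Index n d → Index n d → E) :
    ∑ j, ∑ k, F j k (p.piecewise j k) (p.piecewise k j) =
      ∑ a, ∑ b, ∑ a', ∑ b', F (glue p a b) (glue p a' b') (glue p a b') (glue p a' b) := by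
  simp only [sum_eq_sum_glue p, piecewise_glue]

/-- This is the swap trick: the purity is the expectation, in two copies of the state, of the
operator exchanging the parts of the copies that lie outside `p`. -/
theorem trace_partialTrace_sq (p : Finset (Fin n)) (v : Index n d → ℂ) :
    Matrix.trace (partialTrace p (density v) ^ 2) = purity p v := by
  unfold purity
  rw [sum_piecewise p fun j k l m => v j * (v k * (star (v l) * star (v m)))]
  simp only [Matrix.trace, pow_two, Matrix.mul_apply, partialTrace, density,
    Matrix.vecMulVec_apply, Finset.sum_mul_sum, Matrix.diag_apply, Pi.star_apply]
  calc _ = ∑ b : {i // i ∉ p} → Fin d, ∑ a : {i // i ∈ p} → Fin d,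
        ∑ b' : {i // i ∉ p} → Fin d, ∑ a' : {i // i ∈ p} → Fin d,
        v (glue p a b) * star (v (glue p a b')) * (v (glue p a' b') * star (v (glue p a' b))) :=
        Finset.sum_congr rfl fun _ _ => Finset.sum_comm
    _ = _ := by
      rw [Finset.sum_comm]
      refine Finset.sum_congr rfl fun a _ => Finset.sum_congr rfl fun b _ => ?_
      rw [Finset.sum_comm]
      refine Finset.sum_congr rfl fun a' _ => Finset.sum_congr rfl fun b' _ => ?_
      ring

theorem concurrence_eq (p : Finset (Fin n)) (v : Index n d → ℂ) :
    concurrence p v = 2 * (1 - (purity p v).re) := by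
  rw [concurrence, trace_partialTrace_sq]

theorem continuous_purity (p : Finset (Fin n)) : Continuous (purity (d := d) p) := by
  unfold purity
  fun_prop

theorem integral_purity {Ω : Type*} [MeasurableSpace Ω] [TopologicalSpace Ω] [CompactSpace Ω]
    [OpensMeasurableSpace Ω] {μ : Measure Ω} [IsFiniteMeasure μ] {v : Ω → Index n d → ℂ}
    (hv : ∀ a, Continuous fun ω => v ω a) (p : Finset (Fin n)) :
    ∫ ω, purity p (v ω) ∂μ = contract p (moment μ v) := by
  unfold purity contract moment
  rw [integral_finsetSum]
  · refine Finset.sum_congr rfl fun a _ => ?_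
    rw [integral_finsetSum]
    exact fun b _ => integrable_of_continuous (by fun_prop)
  · exact fun a _ => integrable_of_continuous (by fun_prop)

theorem glue_inj {p : Finset (Fin n)} {a a' : {i // i ∈ p} → Fin d}
    {b b' : {i // i ∉ p} → Fin d} : glue p a b = glue p a' b' ↔ a = a' ∧ b = b' := by
  rw [← Prod.mk_inj]
  exact (glueEquiv d p).injective.eq_iff (a := (a, b)) (b := (a', b'))

/-- Each pairing counts pairs `(j, k)`: those with `j = k` number `d^n`, those agreeing off `p`
number `d^n d^|p|`, and those agreeing on `p` number `d^n d^(n-|p|)`. -/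
theorem contract_pairings (p : Finset (Fin n)) (X Y : ℂ) :
    contract p (fun a b c e : Index n d => X * (if a = b ∧ c = e then 1 else 0) +
      Y * ((if a = c ∧ b = e then 1 else 0) + (if a = e ∧ b = c then 1 else 0))) =
    X * (d : ℂ) ^ n + Y * ((d : ℂ) ^ n * ((d : ℂ) ^ p.card + (d : ℂ) ^ (n - p.card))) := by
  have hd : (d : ℂ) ^ n = (d : ℂ) ^ p.card * (d : ℂ) ^ (n - p.card) := by
    rw [← pow_add, Nat.add_sub_cancel' (by simpa using p.card_le_univ)]
  have hA : Fintype.card {i // i ∈ p} = p.card := Fintype.card_coe p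
  have hB : Fintype.card {i // i ∉ p} = n - p.card := by
    rw [Fintype.card_subtype_compl, Fintype.card_fin, hA]
  unfold contract
  rw [sum_piecewise p fun a b c e : Index n d => X * (if a = b ∧ c = e then (1 : ℂ) else 0) +
      Y * ((if a = c ∧ b = e then (1 : ℂ) else 0) + (if a = e ∧ b = c then (1 : ℂ) else 0))]
  simp only [Finset.sum_add_distrib, ← Finset.mul_sum, glue_inj, true_and, and_true]
  have e1 : ∀ (a a' : {i // i ∈ p} → Fin d) (b b' : {i // i ∉ p} → Fin d),
      (if (a = a' ∧ b = b') ∧ a = a' ∧ b' = b then (1 : ℂ) else 0) =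
        if a = a' then (if b = b' then 1 else 0) else 0 := by
    intros; grind
  have e2 : ∀ (b b' : {i // i ∉ p} → Fin d),
      (if b = b' ∧ b' = b then (1 : ℂ) else 0) =
        if b = b' then 1 else 0 := by
    intros; grind
  have e3 : ∀ (a a' : {i // i ∈ p} → Fin d),
      (if a = a' ∧ a' = a then (1 : ℂ) else 0) =
        if a = a' then 1 else 0 := by
    intros; grind
  simp only [e1, e2, e3]
  simp [hB, hd]
  left
  ring

end Purity

/-! ### Invariance of the surface measure of a sphere -/

section Sphere

open scoped Pointwise

variable {E : Type*} [NormedAddCommGroup E] [InnerProductSpace ℝ E]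

/-- The action of a linear isometry on the unit sphere. -/
def sphereHomeomorph (f : E ≃ₗᵢ[ℝ] E) : Metric.sphere (0 : E) 1 ≃ₜ Metric.sphere (0 : E) 1 where
  toFun x := ⟨f x, by simp⟩
  invFun x := ⟨f.symm x, by simp⟩
  left_inv x := by simp
  right_inv x := by simp
  continuous_toFun := by fun_prop
  continuous_invFun := by fun_prop

/-- The surface measure of a set is a multiple of the volume of the cone over it; forming cones
commutes with a linear isometry, which preserves volume. -/
theorem map_toSphere [MeasurableSpace E] [BorelSpace E] [FiniteDimensional ℝ E]
    (f : E ≃ₗᵢ[ℝ] E) :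
    (volume : Measure E).toSphere.map (sphereHomeomorph f) = (volume : Measure E).toSphere := by
  ext s hs
  have hm : Measurable (sphereHomeomorph f) := (sphereHomeomorph f).continuous.measurable
  rw [Measure.map_apply hm hs, Measure.toSphere_apply' _ (hm hs), Measure.toSphere_apply' _ hs]
  congr 1
  have h : Set.Ioo (0 : ℝ) 1 • (Subtype.val '' (sphereHomeomorph f ⁻¹' s)) =
      f ⁻¹' (Set.Ioo (0 : ℝ) 1 • (Subtype.val '' s)) := by
    ext x
    simp only [Set.mem_smul, Set.mem_image, Set.mem_preimage]
    constructor
    · rintro ⟨r, hr, -, ⟨y, hy, rfl⟩, rfl⟩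
      exact ⟨r, hr, _, ⟨_, hy, rfl⟩, by simp [sphereHomeomorph]⟩
    · rintro ⟨r, hr, -, ⟨y, hy, rfl⟩, h⟩
      refine ⟨r, hr, _, ⟨(sphereHomeomorph f).symm y, by simpa using hy, rfl⟩, ?_⟩
      apply f.injective
      simpa [sphereHomeomorph] using h
  rw [h]
  exact f.measurePreserving.measure_preimage_equiv (f := f.toHomeomorph.toMeasurableEquiv) _

theorem integral_toSphere_comp [MeasurableSpace E] [BorelSpace E] [FiniteDimensional ℝ E]
    {F : Type*} [NormedAddCommGroup F] [NormedSpace ℝ F]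
    (f : E ≃ₗᵢ[ℝ] E) (g : Metric.sphere (0 : E) 1 → F) :
    ∫ x, g (sphereHomeomorph f x) ∂(volume : Measure E).toSphere =
      ∫ x, g x ∂(volume : Measure E).toSphere := by
  conv_rhs => rw [← map_toSphere f]
  exact ((sphereHomeomorph f).measurableEmbedding.integral_map g).symm

end Sphere

/-! ### Unitary matrices acting on vectors -/

section UnitaryAction

variable {ι : Type*} [Fintype ι] [DecidableEq ι]

theorem sum_norm_sq_mulVec {U : Matrix ι ι ℂ} (hU : U ∈ Matrix.unitaryGroup ι ℂ) (v : ι → ℂ) :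
    ∑ a, ‖(U *ᵥ v) a‖ ^ 2 = ∑ a, ‖v a‖ ^ 2 := by
  have key : ∀ w : ι → ℂ, ((∑ a, ‖w a‖ ^ 2 : ℝ) : ℂ) = star w ⬝ᵥ w := fun w => by
    push_cast
    exact Finset.sum_congr rfl fun a _ => (Complex.conj_mul' _).symm
  apply Complex.ofReal_injective
  rw [key, key, Matrix.star_mulVec, Matrix.dotProduct_mulVec, Matrix.vecMul_vecMul,
    ← Matrix.star_eq_conjTranspose, Matrix.mem_unitaryGroup_iff'.1 hU, Matrix.vecMul_one]

/-- The isometry of `ℂ^ι` given by a unitary matrix. -/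
def unitaryIsometry (U : Matrix.unitaryGroup ι ℂ) :
    EuclideanSpace ℂ ι ≃ₗᵢ[ℝ] EuclideanSpace ℂ ι where
  toFun x := WithLp.toLp 2 ((U : Matrix ι ι ℂ) *ᵥ x.ofLp)
  invFun x := WithLp.toLp 2 (star (U : Matrix ι ι ℂ) *ᵥ x.ofLp)
  map_add' x y := by simp [Matrix.mulVec_add]
  map_smul' r x := by simp [Matrix.mulVec_smul]
  left_inv x := by simp [Matrix.mulVec_mulVec]
  right_inv x := by simp [Matrix.mulVec_mulVec]
  norm_map' x := by
    simpa [EuclideanSpace.norm_eq] using congrArg Real.sqrt (sum_norm_sq_mulVec U.2 x.ofLp)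

omit [DecidableEq ι] in
theorem continuous_mulVec_apply {Ω : Type*} [TopologicalSpace Ω] {A : Ω → Matrix ι ι ℂ}
    (hA : Continuous A) (v : ι → ℂ) (a : ι) : Continuous fun ω => (A ω *ᵥ v) a := by
  fun_prop

end UnitaryAction

/-! ### Moments of a random qudit -/

section Qudit

variable {d : ℕ}

theorem isProbabilityMeasure_quditMeasure (hd : 2 ≤ d) : IsProbabilityMeasure (quditMeasure d) := by
  have : Nontrivial (Fin d) := Fin.nontrivial_iff_two_le.2 hd
  refine ⟨?_⟩
  rw [quditMeasure, Measure.smul_apply, smul_eq_mul, ENNReal.inv_mul_cancel]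
  · rw [Measure.measure_univ_ne_zero]
    exact Measure.toSphere_ne_zero _
  · exact measure_ne_top _ _

theorem continuous_qudit (a : Fin d) :
    Continuous fun ψ : QuditState d => (ψ : EuclideanSpace ℂ (Fin d)) a := by
  fun_prop

theorem sum_norm_sq_qudit (ψ : QuditState d) :
    ∑ a, ‖(ψ : EuclideanSpace ℂ (Fin d)) a‖ ^ 2 = 1 := by
  rw [← EuclideanSpace.norm_sq_eq, norm_eq_of_mem_sphere ψ, one_pow]

theorem moment_qudit_invariant (hd : 2 ≤ d) : IsUnitaryInvariant
    (moment (quditMeasure d) fun ψ => (ψ : EuclideanSpace ℂ (Fin d)).ofLp) := by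
  have := isProbabilityMeasure_quditMeasure hd
  intro U hU
  rw [← moment_mulVec continuous_qudit]
  funext a b c e
  unfold moment quditMeasure
  rw [integral_smul_measure, integral_smul_measure]
  congr 1
  exact integral_toSphere_comp (unitaryIsometry ⟨U, hU⟩)
    fun ψ : QuditState d => (ψ : EuclideanSpace ℂ (Fin d)) a *
      ((ψ : EuclideanSpace ℂ (Fin d)) b * (star ((ψ : EuclideanSpace ℂ (Fin d)) c) *
        star ((ψ : EuclideanSpace ℂ (Fin d)) e)))

/-- The redundant conditions are kept so that the summand matches the general invariant tensor
evaluated at labels `a b a b`; likewise `sum_pairings_diag` for `a a b b`. -/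
theorem sum_pairings {ι : Type*} [Fintype ι] [DecidableEq ι] (X Y : ℂ) :
    ∑ a : ι, ∑ b : ι, (X * (if a = b ∧ a = b then 1 else 0) +
      Y * ((if a = a ∧ b = b then 1 else 0) + (if a = b ∧ b = a then 1 else 0))) =
    X * Fintype.card ι + Y * ((Fintype.card ι : ℂ) ^ 2 + Fintype.card ι) := by
  have e3 : ∀ (a a' : ι),
      (if a = a' ∧ a' = a then (1 : ℂ) else 0) = if a = a' then 1 else 0 := by
    intros; grind
  simp only [and_self, e3]
  simp [Finset.sum_add_distrib, ← Finset.mul_sum]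
  ring

theorem sum_pairings_diag {ι : Type*} [Fintype ι] [DecidableEq ι] (X Y : ℂ) :
    ∑ a : ι, ∑ b : ι, (X * (if a = a ∧ b = b then 1 else 0) +
      Y * ((if a = b ∧ a = b then 1 else 0) + (if a = b ∧ a = b then 1 else 0))) =
    X * (Fintype.card ι : ℂ) ^ 2 + Y * (2 * Fintype.card ι) := by
  simp only [and_self]
  simp [Finset.sum_add_distrib, ← Finset.mul_sum]
  ring

/-- The fourth moments of a unit vector whose distribution is unitarily invariant. -/
theorem moment_eq_of_unitaryInvariant {ι Ω : Type*} [Fintype ι] [DecidableEq ι] [Nontrivial ι]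
    [MeasurableSpace Ω] [TopologicalSpace Ω] [CompactSpace Ω] [OpensMeasurableSpace Ω]
    {μ : Measure Ω} [IsProbabilityMeasure μ] {v : Ω → ι → ℂ}
    (hv : ∀ a, Continuous fun ω => v ω a) (hn : ∀ ω, ∑ a, ‖v ω a‖ ^ 2 = 1)
    (h : IsUnitaryInvariant (moment μ v)) (a b c e : ι) :
    moment μ v a b c e = ((Fintype.card ι : ℂ) * (Fintype.card ι + 1))⁻¹ *
      ((if a = c ∧ b = e then 1 else 0) + (if a = e ∧ b = c then 1 else 0)) := by
  obtain ⟨Y, hM⟩ := h.exists_eq (moment_swap μ v)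
  have h1 := sum_moment_trace (μ := μ) hv
  have h2 := sum_pairings (ι := ι) 0 Y
  simp only [zero_mul, zero_add] at h2
  simp only [hn, hM, h2] at h1
  rw [hM, eq_inv_of_mul_eq_one_left (a := Y) (b := (Fintype.card ι : ℂ) * (Fintype.card ι + 1))]
  simp at h1
  linear_combination h1

/-- The fourth moments of a unit vector whose distribution is orthogonally invariant. -/
theorem moment_eq_of_orthogonalInvariant {ι Ω : Type*} [Fintype ι] [DecidableEq ι] [Nontrivial ι]
    [MeasurableSpace Ω] [TopologicalSpace Ω] [CompactSpace Ω] [OpensMeasurableSpace Ω]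
    {μ : Measure Ω} [IsProbabilityMeasure μ] {v : Ω → ι → ℂ}
    (hv : ∀ a, Continuous fun ω => v ω a) (hn : ∀ ω, ∑ a, ‖v ω a‖ ^ 2 = 1)
    {T : ℝ} (hT : ∀ ω, ‖∑ a, v ω a ^ 2‖ ^ 2 = T)
    (h : IsOrthogonalInvariant (moment μ v)) :
    ∃ X Y : ℂ, (X * Fintype.card ι + Y * ((Fintype.card ι : ℂ) ^ 2 + Fintype.card ι) = 1) ∧
      (X * (Fintype.card ι : ℂ) ^ 2 + Y * (2 * Fintype.card ι) = T) ∧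
      moment μ v = fun a b c e => X * (if a = b ∧ c = e then 1 else 0) +
      Y * ((if a = c ∧ b = e then 1 else 0) + (if a = e ∧ b = c then 1 else 0)) := by
  obtain ⟨X, Y, hM⟩ := h.exists_eq (moment_swap μ v)
  have h1 := sum_moment_trace (μ := μ) hv
  have h2 := sum_moment_diag (μ := μ) hv
  rw [Finset.sum_congr rfl fun a _ => Finset.sum_congr rfl fun b _ => hM a b a b,
    sum_pairings] at h1
  rw [Finset.sum_congr rfl fun a _ => Finset.sum_congr rfl fun c _ => hM a a c c,
    sum_pairings_diag] at h2
  refine ⟨X, Y, ?_, ?_, by funext; rw [hM]⟩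
  · simpa [hn] using h1
  · simpa only [hT, integral_const, probReal_univ, one_smul] using h2

theorem moment_qudit (hd : 2 ≤ d) (a b c e : Fin d) :
    moment (quditMeasure d) (fun ψ => (ψ : EuclideanSpace ℂ (Fin d)).ofLp) a b c e =
      ((d : ℂ) * (d + 1))⁻¹ *
        ((if a = c ∧ b = e then 1 else 0) + (if a = e ∧ b = c then 1 else 0)) := by
  have := isProbabilityMeasure_quditMeasure hd
  have : Nontrivial (Fin d) := Fin.nontrivial_iff_two_le.2 hd
  have h := moment_eq_of_unitaryInvariant continuous_qudit sum_norm_sq_qudit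
    (moment_qudit_invariant hd) a b c e
  rwa [Fintype.card_fin] at h

/-- The moments of a random product state. -/
theorem moment_productState {n : ℕ} (hd : 2 ≤ d) (a b c e : Index n d) :
    moment (Measure.pi fun _ : Fin n => quditMeasure d) productState a b c e =
      (((d : ℂ) * (d + 1)) ^ n)⁻¹ * ∑ x : Finset (Fin n),
        if c = x.piecewise a b ∧ e = x.piecewise b a then 1 else 0 := by
  have := isProbabilityMeasure_quditMeasure hd
  have h := integral_fintype_prod_eq_prod (μ := fun _ : Fin n => quditMeasure d)
    fun i (ψ : QuditState d) => (ψ : EuclideanSpace ℂ (Fin d)) (a i) *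
      ((ψ : EuclideanSpace ℂ (Fin d)) (b i) * (star ((ψ : EuclideanSpace ℂ (Fin d)) (c i)) *
        star ((ψ : EuclideanSpace ℂ (Fin d)) (e i))))
  unfold moment productState
  simp only [star_prod, ← Finset.prod_mul_distrib]
  rw [h]
  have h2 := fun i => moment_qudit hd (a i) (b i) (c i) (e i)
  unfold moment at h2
  -- Each party contributes a sum of two pairings. When the product is expanded, `x` is the set of
  -- parties at which `a i = c i`, `b i = e i` is chosen.
  simp only [h2, Finset.prod_mul_distrib, Finset.prod_const, Finset.card_univ, Fintype.card_fin,
    Finset.prod_add, inv_pow]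
  congr 1
  rw [Finset.powerset_univ]
  refine Finset.sum_congr rfl fun x _ => ?_
  simp only [Finset.prod_ite_zero, Finset.prod_const_one, ← ite_and, mul_ite, mul_one, mul_zero]
  congr 1
  simp only [funext_iff, eq_iff_iff, Finset.mem_sdiff, Finset.mem_univ, true_and]
  constructor
  · rintro ⟨h1, h2⟩
    constructor
    · intro i
      by_cases hi : i ∈ x
      · simp [hi, h2 i hi]
      · simp [hi, h1 i hi]
    · intro i
      by_cases hi : i ∈ x
      · simp [hi, h2 i hi]
      · simp [hi, h1 i hi]
  · rintro ⟨h1, h2⟩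
    constructor
    · intro i hi
      simp [h1 i, h2 i, hi]
    · intro i hi
      simp [h1 i, h2 i, hi]

end Qudit

/-! ### Entangling powers of random matrices -/

section RandomMatrix

variable {n d : ℕ}

theorem continuous_productState_apply (j : Index n d) :
    Continuous fun ψ : Fin n → QuditState d => productState ψ j := by
  unfold productState
  fun_prop

theorem continuous_productState :
    Continuous fun ψ : Fin n → QuditState d => productState ψ :=
  continuous_pi continuous_productState_apply

theorem integral_bipartitionMean {Ω : Type*} [MeasurableSpace Ω] {μ : Measure Ω}
    {f : Finset (Fin n) → Ω → ℝ} (hf : ∀ p, Integrable (f p) μ) :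
    ∫ ω, bipartitionMean n (fun p => f p ω) ∂μ = bipartitionMean n fun p => ∫ ω, f p ω ∂μ := by
  unfold bipartitionMean
  rw [integral_const_mul, integral_const_mul, integral_finsetSum _ fun p _ => hf p]

theorem integral_one_sub_re {Ω : Type*} [MeasurableSpace Ω] {μ : Measure Ω}
    [IsProbabilityMeasure μ] {f : Ω → ℂ} (hf : Integrable f μ) :
    ∫ ω, 2 * (1 - (f ω).re) ∂μ = 2 * (1 - (∫ ω, f ω ∂μ).re) := by
  have hre : Integrable (fun ω => (f ω).re) μ := hf.re
  have h2 : ∫ ω, (f ω).re ∂μ = (∫ ω, f ω ∂μ).re := integral_re hf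
  rw [integral_const_mul, integral_sub (integrable_const _) hre, h2]
  simp

theorem continuous_purity_mulVec (p : Finset (Fin n)) :
    Continuous fun x : Matrix (Index n d) (Index n d) ℂ × (Fin n → QuditState d) =>
      purity p (x.1 *ᵥ productState x.2) :=
  (continuous_purity p).comp
    (continuous_fst.matrix_mulVec (continuous_productState.comp continuous_snd))

/-- The mean purity of the states which a matrix produces from product states. -/
def meanPurity (p : Finset (Fin n)) (U : Matrix (Index n d) (Index n d) ℂ) : ℂ :=
  ∫ ψ : Fin n → QuditState d, purity p (U *ᵥ productState ψ)
    ∂Measure.pi fun _ : Fin n => quditMeasure d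

theorem entanglingPower_eq (hd : 2 ≤ d) (U : Matrix (Index n d) (Index n d) ℂ) :
    entanglingPower U = bipartitionMean n fun p => 2 * (1 - (meanPurity p U).re) := by
  have := isProbabilityMeasure_quditMeasure hd
  have hc : ∀ p, Continuous fun ψ : Fin n → QuditState d => purity p (U *ᵥ productState ψ) :=
    fun p => (continuous_purity p).comp (continuous_const.matrix_mulVec continuous_productState)
  unfold entanglingPower oneTangle
  simp only [concurrence_eq]
  rw [integral_bipartitionMean]
  · congr 1
    funext p
    exact integral_one_sub_re (f := fun ψ => purity p (U *ᵥ productState ψ))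
      (integrable_of_continuous (hc p))
  · intro p
    exact integrable_of_continuous
      (continuous_const.mul (continuous_const.sub (Complex.continuous_re.comp (hc p))))

theorem continuous_meanPurity (hd : 2 ≤ d) (p : Finset (Fin n)) :
    Continuous (meanPurity (d := d) p) := by
  have := isProbabilityMeasure_quditMeasure hd
  have : FirstCountableTopology (Matrix (Index n d) (Index n d) ℂ) :=
    inferInstanceAs (FirstCountableTopology (Index n d → Index n d → ℂ))
  have : LocallyCompactSpace (Matrix (Index n d) (Index n d) ℂ) :=
    inferInstanceAs (LocallyCompactSpace (Index n d → Index n d → ℂ))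
  have h := continuous_parametric_integral_of_continuous
    (μ := Measure.pi fun _ : Fin n => quditMeasure d) (s := Set.univ)
    (f := fun (U : Matrix (Index n d) (Index n d) ℂ) ψ => purity p (U *ᵥ productState ψ))
    (continuous_purity_mulVec p) isCompact_univ
  simp only [Measure.restrict_univ] at h
  exact h

theorem continuous_entanglingPower (hd : 2 ≤ d) :
    Continuous (entanglingPower (n := n) (d := d)) := by
  have h := fun p => continuous_meanPurity (n := n) hd p
  have h2 : entanglingPower (n := n) (d := d) =
      fun U => bipartitionMean n fun p => 2 * (1 - (meanPurity p U).re) :=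
    funext fun U => entanglingPower_eq hd U
  rw [h2]
  unfold bipartitionMean
  fun_prop

variable {G : Type*} [TopologicalSpace G] [CompactSpace G] [MeasurableSpace G]
  [OpensMeasurableSpace G] {μ : Measure G} [IsProbabilityMeasure μ]

/-- Exchanging the integrals puts the group average inside, for a fixed product state, where
invariance determines the moments. -/
theorem integral_entanglingPower (hd : 2 ≤ d) {A : G → Matrix (Index n d) (Index n d) ℂ}
    (hA : Continuous A) :
    ∫ g, entanglingPower (A g) ∂μ = bipartitionMean n fun p => 2 * (1 -
      (∫ ψ : Fin n → QuditState d, contract p (moment μ fun g => A g *ᵥ productState ψ)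
        ∂Measure.pi fun _ : Fin n => quditMeasure d).re) := by
  have := isProbabilityMeasure_quditMeasure hd
  have hc : ∀ p, Continuous fun g => meanPurity p (A g) :=
    fun p => (continuous_meanPurity (n := n) hd p).comp hA
  have hs : ∀ p, (∫ g, meanPurity p (A g) ∂μ) = ∫ ψ : Fin n → QuditState d,
      contract p (moment μ fun g => A g *ᵥ productState ψ)
        ∂Measure.pi fun _ : Fin n => quditMeasure d := by
    intro p
    unfold meanPurity
    rw [integral_integral_swap_of_hasCompactSupport]
    · congr 1
      funext ψ
      exact integral_purity (continuous_mulVec_apply hA _) p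
    · exact (continuous_purity p).comp ((hA.comp continuous_fst).matrix_mulVec
        (continuous_productState.comp continuous_snd))
    · exact HasCompactSupport.of_compactSpace _
  simp only [entanglingPower_eq hd]
  rw [integral_bipartitionMean]
  · congr 1
    funext p
    rw [integral_one_sub_re (f := fun g => meanPurity p (A g)) (integrable_of_continuous (hc p)),
      hs]
  · intro p
    exact integrable_of_continuous
      (continuous_const.mul (continuous_const.sub (Complex.continuous_re.comp (hc p))))

end RandomMatrix

/-! ### Haar averages: invariance of the moments of a rotated vector -/

section Haar

variable {ι 𝕜 : Type*} [Fintype ι] [DecidableEq ι] [RCLike 𝕜]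

instance : IsProbabilityMeasure (haarUnitary ι 𝕜) where
  measure_univ := Measure.haarMeasure_self
    (K₀ := (⊤ : TopologicalSpace.PositiveCompacts (Matrix.unitaryGroup ι 𝕜)))

instance : (haarUnitary ι 𝕜).IsMulLeftInvariant := by
  unfold haarUnitary
  infer_instance

theorem moment_haar_unitary_invariant (v : ι → ℂ) : IsUnitaryInvariant
    (moment (haarUnitary ι ℂ) fun U => (U : Matrix ι ι ℂ) *ᵥ v) := by
  intro V hV
  rw [← moment_mulVec (continuous_mulVec_apply continuous_subtype_val v)]
  funext a b c e
  unfold moment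
  have h := integral_mul_left_eq_self (μ := haarUnitary ι ℂ)
    (fun U : Matrix.unitaryGroup ι ℂ => ((U : Matrix ι ι ℂ) *ᵥ v) a *
      (((U : Matrix ι ι ℂ) *ᵥ v) b * (star (((U : Matrix ι ι ℂ) *ᵥ v) c) *
        star (((U : Matrix ι ι ℂ) *ᵥ v) e)))) ⟨V, hV⟩
  simpa only [Matrix.mulVec_mulVec, Submonoid.coe_mul] using h

theorem continuous_orthogonal_map : Continuous fun O : Matrix.orthogonalGroup ι ℝ =>
    (O : Matrix ι ι ℝ).map Complex.ofReal :=
  Continuous.matrix_map continuous_subtype_val Complex.continuous_ofReal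

theorem moment_haar_orthogonal_invariant (v : ι → ℂ) : IsOrthogonalInvariant
    (moment (haarUnitary ι ℝ) fun O => ((O : Matrix ι ι ℝ).map Complex.ofReal) *ᵥ v) := by
  intro V hV
  rw [← moment_mulVec (continuous_mulVec_apply continuous_orthogonal_map v)]
  funext a b c e
  unfold moment
  have hi := integral_mul_left_eq_self (μ := haarUnitary ι ℝ)
    (fun O : Matrix.unitaryGroup ι ℝ => ((O : Matrix ι ι ℝ).map Complex.ofReal *ᵥ v) a *
      (((O : Matrix ι ι ℝ).map Complex.ofReal *ᵥ v) b *
        (star (((O : Matrix ι ι ℝ).map Complex.ofReal *ᵥ v) c) *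
          star (((O : Matrix ι ι ℝ).map Complex.ofReal *ᵥ v) e)))) ⟨V, hV⟩
  have h : ∀ O : Matrix.unitaryGroup ι ℝ,
      ((((⟨V, hV⟩ : Matrix.unitaryGroup ι ℝ) * O : Matrix.unitaryGroup ι ℝ) :
        Matrix ι ι ℝ)).map Complex.ofReal =
      V.map Complex.ofReal * (O : Matrix ι ι ℝ).map Complex.ofReal := fun O =>
    Matrix.map_mul (f := Complex.ofRealHom)
  simpa only [h, Matrix.mulVec_mulVec] using hi

/-- The bilinear form `vᵀv` is a second invariant of the real orthogonal group besides the norm; it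
is what makes the orthogonal mean depend on the input state. -/
theorem sum_sq_orthogonal_mulVec {O : Matrix ι ι ℝ} (hO : O ∈ Matrix.orthogonalGroup ι ℝ)
    (v : ι → ℂ) : ∑ a, (O.map Complex.ofReal *ᵥ v) a ^ 2 = ∑ a, v a ^ 2 := by
  have key : ∀ w : ι → ℂ, ∑ a, w a ^ 2 = w ⬝ᵥ w := fun w =>
    Finset.sum_congr rfl fun a _ => pow_two _
  have h : (O.map Complex.ofReal)ᵀ * O.map Complex.ofReal = 1 := by
    have h := congrArg (fun B : Matrix ι ι ℝ => B.map Complex.ofRealHom)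
      ((Matrix.mem_orthogonalGroup_iff' _ _).1 hO)
    simp only [Matrix.map_mul] at h
    rw [Matrix.map_one _ (map_zero _) (map_one _)] at h
    exact h
  rw [key, key, Matrix.dotProduct_mulVec, ← Matrix.mulVec_transpose, Matrix.mulVec_mulVec, h,
    Matrix.one_mulVec]

end Haar

/-! ### Mean entangling power over the unitary and the orthogonal group -/

section Means

variable {n d : ℕ}

theorem sum_properParts (hn : 2 ≤ n) (F : Finset (Fin n) → ℝ) :
    ∑ p ∈ properParts n, F p = ∑ p, F p - F ∅ - F Finset.univ := by
  have : Nonempty (Fin n) := ⟨⟨0, by omega⟩⟩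
  have h : properParts n = (Finset.univ.erase ∅).erase Finset.univ := by
    ext p
    simp [properParts, Finset.nonempty_iff_ne_empty, and_comm]
  rw [h, Finset.sum_erase_eq_sub, Finset.sum_erase_eq_sub (Finset.mem_univ _)]
  simp [Finset.univ_nonempty.ne_empty]

/-- The mean of the sums of the dimensions of the two parts of a bipartition. -/
theorem bipartitionMean_dim (hn : 2 ≤ n) (x y : ℝ) :
    bipartitionMean n (fun p => x - y * ((d : ℝ) ^ p.card + (d : ℝ) ^ (n - p.card))) =
      1 / ((2 : ℝ) ^ (n - 1) - 1) *
        (x * ((2 : ℝ) ^ (n - 1) - 1) - y * (((d : ℝ) + 1) ^ n - (d : ℝ) ^ n - 1)) := by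
  have h1 : ∑ p : Finset (Fin n), (d : ℝ) ^ p.card = ((d : ℝ) + 1) ^ n := by
    simpa using (Finset.prod_add (fun _ : Fin n => (d : ℝ)) (fun _ => (1 : ℝ)) Finset.univ).symm
  have h2 : ∑ p : Finset (Fin n), (d : ℝ) ^ (n - p.card) = ((d : ℝ) + 1) ^ n := by
    rw [← h1]
    refine Fintype.sum_equiv (compl_involutive (α := Finset (Fin n))).toPerm _ _ fun p => ?_
    simp [Finset.card_compl]
  have h3 : (2 : ℝ) ^ n = 2 * 2 ^ (n - 1) := by
    rw [← pow_succ', Nat.sub_add_cancel (by omega)]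
  rw [bipartitionMean, sum_properParts hn]
  simp only [Finset.sum_sub_distrib, ← Finset.mul_sum, Finset.sum_add_distrib, h1, h2]
  simp [h3]
  left
  ring

theorem two_pow_pred_sub_one_pos (hn : 2 ≤ n) : (0 : ℝ) < 2 ^ (n - 1) - 1 := by
  have : (1 : ℝ) < 2 ^ (n - 1) := one_lt_pow₀ (by norm_num) (by omega)
  linarith

theorem sum_norm_sq_productState (ψ : Fin n → QuditState d) :
    ∑ a, ‖productState ψ a‖ ^ 2 = 1 := by
  simp only [productState, norm_prod, ← Finset.prod_pow]
  rw [← Fintype.prod_sum fun i (a : Fin d) => ‖(ψ i : EuclideanSpace ℂ (Fin d)) a‖ ^ 2]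
  simp [sum_norm_sq_qudit]

theorem nontrivial_index (hn : 2 ≤ n) (hd : 2 ≤ d) : Nontrivial (Index n d) := by
  have : Nontrivial (Fin d) := Fin.nontrivial_iff_two_le.2 hd
  have : Nonempty (Fin n) := ⟨⟨0, by omega⟩⟩
  infer_instance

/-- The mean entangling power of the unitary matrices. -/
theorem integral_entanglingPower_unitary (hn : 2 ≤ n) (hd : 2 ≤ d) :
    ∫ U : Matrix.unitaryGroup (Index n d) ℂ,
        entanglingPower (U : Matrix (Index n d) (Index n d) ℂ) ∂haarUnitary (Index n d) ℂ
      = ((2 : ℝ) ^ n * ((d : ℝ) ^ n + 1) - 2 * ((d : ℝ) + 1) ^ n) /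
          (((2 : ℝ) ^ (n - 1) - 1) * ((d : ℝ) ^ n + 1)) := by
  have := isProbabilityMeasure_quditMeasure hd
  have := nontrivial_index hn hd
  have hd0 : (d : ℝ) ^ n ≠ 0 := by positivity
  have hc : ∀ (ψ : Fin n → QuditState d) (p : Finset (Fin n)),
      contract p (moment (haarUnitary (Index n d) ℂ)
        fun U => (U : Matrix (Index n d) (Index n d) ℂ) *ᵥ productState ψ) =
      ((((d : ℝ) ^ n + 1)⁻¹ * ((d : ℝ) ^ p.card + (d : ℝ) ^ (n - p.card)) : ℝ) : ℂ) := by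
    intro ψ p
    have h := contract_pairings (d := d) p 0
      ((Fintype.card (Index n d) : ℂ) * (Fintype.card (Index n d) + 1))⁻¹
    simp only [zero_mul, zero_add] at h
    have hm := moment_eq_of_unitaryInvariant (μ := haarUnitary (Index n d) ℂ)
      (v := fun U => (U : Matrix (Index n d) (Index n d) ℂ) *ᵥ productState ψ)
      (continuous_mulVec_apply continuous_subtype_val _)
      (fun U => by rw [sum_norm_sq_mulVec U.2, sum_norm_sq_productState])
      (moment_haar_unitary_invariant _)
    rw [show moment (haarUnitary (Index n d) ℂ)
      (fun U => (U : Matrix (Index n d) (Index n d) ℂ) *ᵥ productState ψ) = _ from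
      funext fun a => funext fun b => funext fun c => funext fun e => hm a b c e, h]
    have hd1 : (d : ℂ) ^ n ≠ 0 := by exact_mod_cast hd0
    simp
    field_simp
  rw [integral_entanglingPower hd continuous_subtype_val]
  simp only [hc, integral_const, probReal_univ, one_smul, Complex.ofReal_re]
  have hb := bipartitionMean_dim (d := d) hn 2 (2 * ((d : ℝ) ^ n + 1)⁻¹)
  have h2 := (two_pow_pred_sub_one_pos hn).ne'
  have h3 : (2 : ℝ) ^ n = 2 * 2 ^ (n - 1) := by
    rw [← pow_succ', Nat.sub_add_cancel (by omega)]
  have h4 : (d : ℝ) ^ n + 1 ≠ 0 := by positivity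
  simp only [mul_sub, mul_one, ← mul_assoc] at hb ⊢
  rw [hb, h3]
  field_simp
  ring

/-- The quantity factorizes over the parties, and the moments of one qudit give each factor the mean
`2d / (d(d+1))`. -/
theorem integral_sum_sq_productState (hd : 2 ≤ d) :
    (∫ ψ : Fin n → QuditState d, ((‖∑ a, productState ψ a ^ 2‖ ^ 2 : ℝ) : ℂ)
      ∂Measure.pi fun _ : Fin n => quditMeasure d) = (2 / ((d : ℂ) + 1)) ^ n := by
  have := isProbabilityMeasure_quditMeasure hd
  have h : ∀ ψ : Fin n → QuditState d, ((‖∑ a, productState ψ a ^ 2‖ ^ 2 : ℝ) : ℂ) =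
      ∏ i, ((‖∑ a, (ψ i : EuclideanSpace ℂ (Fin d)) a ^ 2‖ ^ 2 : ℝ) : ℂ) := by
    intro ψ
    simp only [productState, ← Finset.prod_pow]
    rw [← Fintype.prod_sum fun i (a : Fin d) => (ψ i : EuclideanSpace ℂ (Fin d)) a ^ 2, norm_prod,
      ← Finset.prod_pow, Complex.ofReal_prod]
  simp only [h]
  rw [integral_fintype_prod_eq_prod (μ := fun _ : Fin n => quditMeasure d)
    fun i (ψ : QuditState d) =>
      ((‖∑ a, (ψ : EuclideanSpace ℂ (Fin d)) a ^ 2‖ ^ 2 : ℝ) : ℂ)]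
  have h1 := sum_moment_diag (μ := quditMeasure d)
    (v := fun ψ => (ψ : EuclideanSpace ℂ (Fin d)).ofLp) continuous_qudit
  rw [Finset.sum_congr rfl fun a _ => Finset.sum_congr rfl fun c _ => moment_qudit hd a a c c] at h1
  have h2 := sum_pairings_diag (ι := Fin d) 0 ((d : ℂ) * (d + 1))⁻¹
  simp only [zero_mul, zero_add] at h2
  rw [h2] at h1
  rw [Finset.prod_const, Finset.card_univ, Fintype.card_fin, ← h1]
  have hd0 : (d : ℂ) ≠ 0 := by norm_cast; omega
  have hd1 : (d : ℂ) + 1 ≠ 0 := by norm_cast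
  congr 1
  rw [Fintype.card_fin]
  field_simp

/-- The mean entangling power of the orthogonal matrices. -/
theorem integral_entanglingPower_orthogonal (hn : 2 ≤ n) (hd : 2 ≤ d) :
    ∫ O : Matrix.orthogonalGroup (Index n d) ℝ,
        entanglingPower ((O : Matrix (Index n d) (Index n d) ℝ).map Complex.ofReal)
          ∂haarUnitary (Index n d) ℝ
      = (((2 : ℝ) ^ n * ((d : ℝ) ^ n + 1) - 2 * ((d : ℝ) + 1) ^ n) *
            ((d : ℝ) ^ n * ((d : ℝ) + 1) ^ n - (2 : ℝ) ^ n)) /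
          (((2 : ℝ) ^ (n - 1) - 1) * ((d : ℝ) ^ (2 * n) + (d : ℝ) ^ n - 2) *
            ((d : ℝ) + 1) ^ n) := by
  have := isProbabilityMeasure_quditMeasure hd
  have := nontrivial_index hn hd
  have hd0 : (0 : ℝ) < (d : ℝ) ^ n := by positivity
  have hd1 : (1 : ℝ) < (d : ℝ) ^ n := one_lt_pow₀ (by exact_mod_cast hd) (by omega)
  set D : ℝ := (d : ℝ) ^ n with hD
  have hden : D ^ 2 + D - 2 ≠ 0 := by nlinarith
  -- the mean over the orthogonal group as an affine function of `|ψᵀψ|²`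
  have hc : ∀ (p : Finset (Fin n)) (ψ : Fin n → QuditState d),
      contract p (moment (haarUnitary (Index n d) ℝ)
        fun O => ((O : Matrix (Index n d) (Index n d) ℝ).map Complex.ofReal) *ᵥ productState ψ) =
      1 - (((D ^ 2 + D - 2)⁻¹ * (D + 1 - ((d : ℝ) ^ p.card + (d : ℝ) ^ (n - p.card))) : ℝ) : ℂ) *
        (D - ((‖∑ a, productState ψ a ^ 2‖ ^ 2 : ℝ) : ℂ)) := by
    intro p ψ
    obtain ⟨X, Y, h1, h2, hm⟩ := moment_eq_of_orthogonalInvariant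
      (μ := haarUnitary (Index n d) ℝ)
      (v := fun O => ((O : Matrix (Index n d) (Index n d) ℝ).map Complex.ofReal) *ᵥ productState ψ)
      (T := ‖∑ a, productState ψ a ^ 2‖ ^ 2)
      (continuous_mulVec_apply continuous_orthogonal_map _)
      (fun O => by
        rw [sum_norm_sq_mulVec (map_ofReal_mem_unitaryGroup O.2), sum_norm_sq_productState])
      (fun O => by rw [sum_sq_orthogonal_mulVec O.2])
      (moment_haar_orthogonal_invariant _)
    rw [hm, contract_pairings]
    generalize ‖∑ a, productState ψ a ^ 2‖ ^ 2 = T at *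
    have hcard : (Fintype.card (Index n d) : ℂ) = (D : ℂ) := by simp [hD]
    have hdD : (d : ℂ) ^ n = (D : ℂ) := by simp [hD]
    have hden' : (D : ℂ) ^ 2 + D - 2 ≠ 0 := by exact_mod_cast hden
    rw [hcard] at h1 h2
    rw [hdD]
    push_cast
    -- Eliminating `X` from `X D + Y (D² + D) = 1` and `X D² + 2 Y D = T`.
    have hY : Y * D * ((D : ℂ) ^ 2 + D - 2) = D - T := by linear_combination D * h1 - h2
    have hY' : Y * D = ((D : ℂ) ^ 2 + D - 2)⁻¹ * (D - T) := by
      rw [← hY, mul_comm _⁻¹, mul_inv_cancel_right₀ hden']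
    linear_combination h1 + ((d : ℂ) ^ p.card + (d : ℂ) ^ (n - p.card) - D - 1) * hY'
  have hint : ∀ p : Finset (Fin n), (∫ ψ : Fin n → QuditState d,
      contract p (moment (haarUnitary (Index n d) ℝ)
        fun O => ((O : Matrix (Index n d) (Index n d) ℝ).map Complex.ofReal) *ᵥ productState ψ)
        ∂Measure.pi fun _ : Fin n => quditMeasure d) =
      ((1 - (D ^ 2 + D - 2)⁻¹ * (D + 1 - ((d : ℝ) ^ p.card + (d : ℝ) ^ (n - p.card))) *
        (D - (2 / ((d : ℝ) + 1)) ^ n) : ℝ) : ℂ) := by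
    intro p
    simp only [hc]
    have hT : Integrable (fun ψ : Fin n → QuditState d =>
        ((‖∑ a, productState ψ a ^ 2‖ ^ 2 : ℝ) : ℂ))
        (Measure.pi fun _ : Fin n => quditMeasure d) := by
      have := continuous_productState_apply (n := n) (d := d)
      exact integrable_of_continuous (by fun_prop)
    have hT' : Integrable (fun ψ : Fin n → QuditState d =>
        (D : ℂ) - ((‖∑ a, productState ψ a ^ 2‖ ^ 2 : ℝ) : ℂ))
        (Measure.pi fun _ : Fin n => quditMeasure d) := (integrable_const _).sub hT
    rw [integral_sub (integrable_const _) (hT'.const_mul _),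
      integral_const_mul, integral_sub (integrable_const _) hT, integral_sum_sq_productState hd]
    simp
  rw [integral_entanglingPower hd continuous_orthogonal_map]
  simp only [hint, Complex.ofReal_re]
  -- The two arguments are the constant term and the coefficient of `d^|p| + d^(n-|p|)` in twice one
  -- minus the mean purity.
  have hb := bipartitionMean_dim (d := d) hn
    (2 * ((D ^ 2 + D - 2)⁻¹ * (D + 1) * (D - (2 / ((d : ℝ) + 1)) ^ n)))
    (2 * ((D ^ 2 + D - 2)⁻¹ * (D - (2 / ((d : ℝ) + 1)) ^ n)))
  have h2 := (two_pow_pred_sub_one_pos hn).ne'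
  have h3 : (2 : ℝ) ^ n = 2 * 2 ^ (n - 1) := by
    rw [← pow_succ', Nat.sub_add_cancel (by omega)]
  have h4 : ((d : ℝ) + 1) ^ n ≠ 0 := by positivity
  have h5 : (d : ℝ) ^ (2 * n) = D ^ 2 := by rw [hD, ← pow_mul, mul_comm]
  rw [← hD] at hb
  refine Eq.trans ?_ (hb.trans ?_)
  · congr 1
    funext p
    ring
  · rw [h5, div_pow]
    field_simp
    rw [h3]
    ring

end Means

/-! ### A lower bound for the purity -/

section PurityBound

variable {P R : Type*} [Fintype P] [Fintype R]

/-- The purity of a vector of a tensor product of two spaces. -/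
def bipartitePurity (W : P → R → ℂ) : ℂ :=
  ∑ A, ∑ B, ∑ A', ∑ B', W A B * (W A' B' * (star (W A B') * star (W A' B)))

/-- The purity is the squared Hilbert–Schmidt norm of the reduced matrix `∑ A, W A B * star (W A
B')`; in particular it is real. -/
theorem bipartitePurity_eq (W : P → R → ℂ) :
    bipartitePurity W = ((∑ B, ∑ B', ‖∑ A, W A B * star (W A B')‖ ^ 2 : ℝ) : ℂ) := by
  push_cast
  simp only [← Complex.mul_conj', map_sum, Finset.sum_mul_sum]
  unfold bipartitePurity
  rw [Finset.sum_comm]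
  refine Finset.sum_congr rfl fun B _ => ?_
  calc _ = ∑ A, ∑ B', ∑ A', W A B * (W A' B' * (star (W A B') * star (W A' B))) :=
        Finset.sum_congr rfl fun _ _ => Finset.sum_comm
    _ = _ := by
      rw [Finset.sum_comm]
      refine Finset.sum_congr rfl fun B' _ => Finset.sum_congr rfl fun A _ =>
        Finset.sum_congr rfl fun A' _ => ?_
      simp only [map_mul, starRingEnd_apply, star_star]
      ring

theorem bipartitePurity_flip (W : P → R → ℂ) :
    bipartitePurity (fun B A => W A B) = bipartitePurity W := by
  unfold bipartitePurity
  rw [Finset.sum_comm]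
  refine Finset.sum_congr rfl fun A _ => Finset.sum_congr rfl fun B _ => ?_
  rw [Finset.sum_comm]
  refine Finset.sum_congr rfl fun A' _ => Finset.sum_congr rfl fun B' _ => ?_
  ring

/-- Cauchy–Schwarz bounds the squared trace of the reduced matrix by its size times the sum of its
squared diagonal entries; the remaining entries only increase the Hilbert–Schmidt norm. -/
theorem sq_sum_norm_sq_le_right (W : P → R → ℂ) :
    (∑ A, ∑ B, ‖W A B‖ ^ 2) ^ 2 ≤ Fintype.card R * (bipartitePurity W).re := by
  rw [bipartitePurity_eq, Complex.ofReal_re, Finset.sum_comm]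
  refine (sq_sum_le_card_mul_sum_sq (s := Finset.univ) (f := fun B => ∑ A, ‖W A B‖ ^ 2)).trans ?_
  refine mul_le_mul_of_nonneg_left (Finset.sum_le_sum fun B _ => ?_) (Nat.cast_nonneg _)
  refine le_trans (le_of_eq ?_) (Finset.single_le_sum (f := fun B' =>
    ‖∑ A, W A B * star (W A B')‖ ^ 2) (fun _ _ => sq_nonneg _) (Finset.mem_univ B))
  have h : ∑ A, W A B * star (W A B) = ((∑ A, ‖W A B‖ ^ 2 : ℝ) : ℂ) := by
    push_cast
    exact Finset.sum_congr rfl fun A _ => Complex.mul_conj' _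
  rw [h, Complex.norm_real, Real.norm_eq_abs, sq_abs]

theorem sq_sum_norm_sq_le_left (W : P → R → ℂ) :
    (∑ A, ∑ B, ‖W A B‖ ^ 2) ^ 2 ≤ Fintype.card P * (bipartitePurity W).re := by
  rw [← bipartitePurity_flip, Finset.sum_comm]
  exact sq_sum_norm_sq_le_right fun B A => W A B

end PurityBound

/-! ### Purity of a unitary matrix as a vector of the doubled space, and the upper bound -/

section OperatorPurity

variable {n d : ℕ}

/-- The purity of a matrix, considered as a vector of the doubled space, for the bipartition
of the doubled space given by `p` and `x`. -/
def operatorPurity (p x : Finset (Fin n)) (U : Matrix (Index n d) (Index n d) ℂ) : ℂ :=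
  ∑ j, ∑ k, ∑ a, ∑ b, U j a * (U k b * (star (U (p.piecewise j k) (x.piecewise a b)) *
    star (U (p.piecewise k j) (x.piecewise b a))))

theorem operatorPurity_eq (p x : Finset (Fin n)) (U : Matrix (Index n d) (Index n d) ℂ) :
    operatorPurity p x U =
      bipartitePurity fun (A : ({i // i ∈ p} → Fin d) × ({i // i ∈ x} → Fin d))
        (B : ({i // i ∉ p} → Fin d) × ({i // i ∉ x} → Fin d)) =>
          U (glue p A.1 B.1) (glue x A.2 B.2) := by
  unfold operatorPurity bipartitePurity
  rw [sum_piecewise p fun j k l m => ∑ a, ∑ b, U j a * (U k b * (star (U l (x.piecewise a b)) *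
    star (U m (x.piecewise b a))))]
  simp only [Fintype.sum_prod_type]
  have h : ∀ j k l m, ∑ a, ∑ b, U j a * (U k b * (star (U l (x.piecewise a b)) *
      star (U m (x.piecewise b a)))) = _ := fun j k l m =>
    sum_piecewise x fun a b c e => U j a * (U k b * (star (U l c) * star (U m e)))
  simp only [h]
  refine Finset.sum_congr rfl fun α _ => ?_
  calc _ = ∑ β, ∑ α', ∑ γ, ∑ β', ∑ δ, ∑ γ', ∑ δ', _ :=
        Finset.sum_congr rfl fun β _ => Finset.sum_congr rfl fun α' _ => Finset.sum_comm
    _ = ∑ β, ∑ γ, ∑ α', ∑ β', ∑ δ, ∑ γ', ∑ δ', _ :=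
        Finset.sum_congr rfl fun β _ => Finset.sum_comm
    _ = ∑ γ, ∑ β, ∑ α', ∑ β', ∑ δ, ∑ γ', ∑ δ', _ := Finset.sum_comm
    _ = ∑ γ, ∑ β, ∑ α', ∑ δ, ∑ β', ∑ γ', ∑ δ', _ :=
        Finset.sum_congr rfl fun γ _ => Finset.sum_congr rfl fun β _ =>
          Finset.sum_congr rfl fun α' _ => Finset.sum_comm
    _ = ∑ γ, ∑ β, ∑ δ, ∑ α', ∑ β', ∑ γ', ∑ δ', _ :=
        Finset.sum_congr rfl fun γ _ => Finset.sum_congr rfl fun β _ => Finset.sum_comm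
    _ = _ :=
        Finset.sum_congr rfl fun γ _ => Finset.sum_congr rfl fun β _ =>
          Finset.sum_congr rfl fun δ _ => Finset.sum_congr rfl fun α' _ => Finset.sum_comm

theorem sum_norm_sq_unitary {ι : Type*} [Fintype ι] [DecidableEq ι] {U : Matrix ι ι ℂ}
    (hU : U ∈ Matrix.unitaryGroup ι ℂ) : ∑ a, ∑ b, ‖U a b‖ ^ 2 = Fintype.card ι := by
  have h : ∀ a, ∑ b, ‖U a b‖ ^ 2 = 1 := by
    intro a
    have h1 := congrFun (congrFun ((Matrix.mem_unitaryGroup_iff).1 hU) a) a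
    rw [Matrix.mul_apply, Matrix.one_apply_eq] at h1
    apply Complex.ofReal_injective
    push_cast
    rw [← h1]
    exact Finset.sum_congr rfl fun b _ => (Complex.mul_conj' _).symm
  simp [h]

/-- Unitarity enters only through the squared Hilbert–Schmidt norm `d^n` of `U`. The purity can be
bounded through either part, so the smaller dimension may be used. -/
theorem sq_le_operatorPurity {U : Matrix (Index n d) (Index n d) ℂ}
    (hU : U ∈ Matrix.unitaryGroup (Index n d) ℂ) (p x : Finset (Fin n)) :
    ((d : ℝ) ^ n) ^ 2 ≤ (min (subsystemDim d p x) (subsystemDim d pᶜ xᶜ) : ℕ) *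
      (operatorPurity p x U).re := by
  have hs := sum_norm_sq_unitary hU
  rw [sum_eq_sum_glue p] at hs
  simp only [sum_eq_sum_glue x] at hs
  have hs' : ∑ A : ({i // i ∈ p} → Fin d) × ({i // i ∈ x} → Fin d),
      ∑ B : ({i // i ∉ p} → Fin d) × ({i // i ∉ x} → Fin d),
        ‖U (glue p A.1 B.1) (glue x A.2 B.2)‖ ^ 2 = (d : ℝ) ^ n := by
    simp only [Fintype.sum_prod_type]
    rw [show (d : ℝ) ^ n = Fintype.card (Index n d) by simp, ← hs]
    exact Finset.sum_congr rfl fun _ _ => Finset.sum_comm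
  rw [operatorPurity_eq, ← hs']
  rcases min_choice (subsystemDim d p x) (subsystemDim d pᶜ xᶜ) with h | h
  · rw [h]
    refine (sq_sum_norm_sq_le_left _).trans_eq ?_
    simp [subsystemDim]
  · rw [h]
    refine (sq_sum_norm_sq_le_right _).trans_eq ?_
    simp [subsystemDim, Finset.card_compl, Fintype.card_subtype_compl]

/-- In each term of the moments of a product state the two conjugated labels are determined by `a`,
`b` and `x`, so the action of `U` collapses to a double sum, and the contraction over `p` makes it
the purity of `U` itself. -/
theorem meanPurity_eq (hd : 2 ≤ d) (p : Finset (Fin n)) (U : Matrix (Index n d) (Index n d) ℂ) :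
    meanPurity p U = (((d : ℂ) * (d + 1)) ^ n)⁻¹ * ∑ x, operatorPurity p x U := by
  have := isProbabilityMeasure_quditMeasure hd
  have hc : ∀ a, Continuous fun ψ : Fin n → QuditState d => (U *ᵥ productState ψ) a := by
    have := continuous_productState_apply (n := n) (d := d)
    intro a
    fun_prop
  have ht : ∀ j k l m, tensorAct U (fun a b c e : Index n d => (((d : ℂ) * (d + 1)) ^ n)⁻¹ *
      ∑ x : Finset (Fin n), if c = x.piecewise a b ∧ e = x.piecewise b a then 1 else 0) j k l m =
      (((d : ℂ) * (d + 1)) ^ n)⁻¹ * ∑ x : Finset (Fin n), ∑ a, ∑ b, U j a * (U k b *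
        (star (U l (x.piecewise a b)) * star (U m (x.piecewise b a)))) := by
    intro j k l m
    unfold tensorAct
    rw [Finset.sum_comm, Finset.mul_sum]
    refine Finset.sum_congr rfl fun a _ => ?_
    rw [Finset.sum_comm, Finset.mul_sum, Finset.mul_sum]
    refine Finset.sum_congr rfl fun b _ => ?_
    simp only [mul_left_comm (star _) _⁻¹, ← Finset.mul_sum]
    rw [mul_left_comm (U k b), mul_left_comm (U j a)]
    congr 1
    simp only [Finset.mul_sum]
    calc _ = ∑ c, ∑ x : Finset (Fin n), ∑ e, U j a * (U k b * (star (U l c) * (star (U m e) *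
          if c = x.piecewise a b ∧ e = x.piecewise b a then 1 else 0))) :=
          Finset.sum_congr rfl fun _ _ => Finset.sum_comm
      _ = _ := by
        rw [Finset.sum_comm]
        refine Finset.sum_congr rfl fun x _ => ?_
        simp [ite_and]
  unfold meanPurity
  rw [integral_purity hc, moment_mulVec continuous_productState_apply]
  rw [show moment (Measure.pi fun _ : Fin n => quditMeasure d) productState = _ from
    funext fun a => funext fun b => funext fun c => funext fun e =>
      moment_productState (n := n) hd a b c e]
  unfold contract operatorPurity
  simp only [ht, ← Finset.mul_sum]
  congr 1
  rw [Finset.sum_comm (s := (Finset.univ : Finset (Finset (Fin n))))]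
  exact Finset.sum_congr rfl fun j _ => Finset.sum_comm

theorem subsystemDim_pos (hd : 2 ≤ d) (p x : Finset (Fin n)) : 0 < subsystemDim d p x := by
  unfold subsystemDim
  positivity

/-- Distributing `2^n` as one unit per subset turns each bracket into `1 - (m - 1)/m = 1/m`, the
form in which the purity bound appears. -/
theorem bipartitionBound_eq (hd : 2 ≤ d) (p : Finset (Fin n)) :
    bipartitionBound d p = 2 * (1 - ((d : ℝ) / (d + 1)) ^ n * ∑ x : Finset (Fin n),
      ((min (subsystemDim d p x) (subsystemDim d pᶜ xᶜ) : ℕ) : ℝ)⁻¹) := by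
  unfold bipartitionBound
  have h : (2 : ℝ) ^ n = ∑ x : Finset (Fin n), 1 := by simp
  rw [h, ← Finset.sum_sub_distrib, Finset.prod_const, Finset.card_univ, Fintype.card_fin]
  have h2 : ∀ x : Finset (Fin n),
      (1 - ((min (subsystemDim d p x) (subsystemDim d pᶜ xᶜ) : ℕ) - 1 : ℝ) /
        (min (subsystemDim d p x) (subsystemDim d pᶜ xᶜ) : ℕ)) =
      ((min (subsystemDim d p x) (subsystemDim d pᶜ xᶜ) : ℕ) : ℝ)⁻¹ := by
    intro x
    have hm : ((min (subsystemDim d p x) (subsystemDim d pᶜ xᶜ) : ℕ) : ℝ) ≠ 0 := by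
      exact_mod_cast (lt_min (subsystemDim_pos hd p x) (subsystemDim_pos hd pᶜ xᶜ)).ne'
    field_simp
    ring
  simp only [h2]
  ring

theorem bipartitionMean_mono (hn : 2 ≤ n) {f g : Finset (Fin n) → ℝ} (h : ∀ p, f p ≤ g p) :
    bipartitionMean n f ≤ bipartitionMean n g := by
  have h2 := two_pow_pred_sub_one_pos hn
  unfold bipartitionMean
  gcongr
  exact h _

theorem entanglingPower_le (hn : 2 ≤ n) (hd : 2 ≤ d) {U : Matrix (Index n d) (Index n d) ℂ}
    (hU : U ∈ Matrix.unitaryGroup (Index n d) ℂ) :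
    entanglingPower U ≤ entanglingPowerBound n d := by
  rw [entanglingPower_eq hd, entanglingPowerBound]
  refine bipartitionMean_mono hn fun p => ?_
  rw [bipartitionBound_eq hd, meanPurity_eq hd]
  have hre : ((((d : ℂ) * (d + 1)) ^ n)⁻¹ * ∑ x, operatorPurity p x U).re =
      (((d : ℝ) * (d + 1)) ^ n)⁻¹ * ∑ x, (operatorPurity p x U).re := by
    rw [← Complex.re_sum, ← Complex.re_ofReal_mul]
    push_cast
    rfl
  rw [hre]
  have hsum : ((d : ℝ) / (d + 1)) ^ n * ∑ x : Finset (Fin n),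
      ((min (subsystemDim d p x) (subsystemDim d pᶜ xᶜ) : ℕ) : ℝ)⁻¹ ≤
      (((d : ℝ) * (d + 1)) ^ n)⁻¹ * ∑ x, (operatorPurity p x U).re := by
    have hd0 : (0 : ℝ) < d := by positivity
    -- This splits the prefactor into the normalization of the product-state moments and the squared
    -- norm bounded in `sq_le_operatorPurity`.
    have hc : ((d : ℝ) / (d + 1)) ^ n = (((d : ℝ) * (d + 1)) ^ n)⁻¹ * ((d : ℝ) ^ n) ^ 2 := by
      rw [div_pow, mul_pow]
      field_simp
    rw [hc, mul_assoc, Finset.mul_sum]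
    gcongr with x
    have hm : (0 : ℝ) < ((min (subsystemDim d p x) (subsystemDim d pᶜ xᶜ) : ℕ) : ℝ) := by
      exact_mod_cast lt_min (subsystemDim_pos hd p x) (subsystemDim_pos hd pᶜ xᶜ)
    rw [mul_inv_le_iff₀ hm, mul_comm (Complex.re _)]
    exact sq_le_operatorPurity hU p x
  linarith

end OperatorPurity

/-! ### The explicit form of the bound -/

section ExplicitBound

variable {n d : ℕ}

theorem sum_card_eq_sum_choose (F : ℕ → ℝ) :
    ∑ x : Finset (Fin n), F x.card = ∑ j ∈ Finset.range (n + 1), (n.choose j : ℝ) * F j := by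
  have h := Finset.sum_powerset_apply_card F (x := (Finset.univ : Finset (Fin n)))
  simpa using h

theorem sum_properParts_card (hn : 2 ≤ n) (F : ℕ → ℝ) :
    ∑ p ∈ properParts n, F p.card = ∑ l ∈ Finset.Icc 1 (n - 1), (n.choose l : ℝ) * F l := by
  rw [sum_properParts hn, sum_card_eq_sum_choose F, Finset.sum_range_succ]
  obtain ⟨m, rfl⟩ : ∃ m, n = m + 1 := ⟨n - 1, by omega⟩
  rw [Finset.sum_range_succ', Finset.range_eq_Ico, Finset.sum_Ico_add' (fun l =>
    ((m + 1).choose l : ℝ) * F l) 0 m 1]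
  have : Finset.Icc 1 (m + 1 - 1) = Finset.Ico (0 + 1) (m + 1) := by
    ext
    simp
  rw [this]
  simp
  ring

/-- Sums that are symmetric about `n / 2` are twice the sums up to `n / 2`, where a term in the
middle counts one half. -/
theorem sum_symm_half (n : ℕ) {h : ℕ → ℝ} (hs : ∀ l, l ≤ n → h (n - l) = h l) :
    1 / 2 * ∑ l ∈ Finset.Icc 1 (n - 1), h l =
      ∑ l ∈ Finset.Icc 1 (n / 2), h l * (if 2 * l = n then 1 / 2 else 1) := by
  -- The weights satisfy `w l + w (n - l) = 1`, so by symmetry the weighted sum is half of the full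
  -- one; they vanish above `n / 2`.
  set w : ℕ → ℝ := fun l => if 2 * l < n then 1 else if 2 * l = n then 1 / 2 else 0 with hw
  have h1 : ∑ l ∈ Finset.Icc 1 (n - 1), w (n - l) * h (n - l) =
      ∑ l ∈ Finset.Icc 1 (n - 1), w l * h l := by
    refine Finset.sum_nbij' (fun l => n - l) (fun l => n - l) ?_ ?_ ?_ ?_ fun _ _ => rfl
    all_goals
      intro l hl
      simp only [Finset.mem_Icc] at hl ⊢
      omega
  have h2 : ∑ l ∈ Finset.Icc 1 (n - 1), h l = 2 * ∑ l ∈ Finset.Icc 1 (n - 1), w l * h l := by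
    rw [two_mul]
    nth_rewrite 1 [← h1]
    rw [← Finset.sum_add_distrib]
    refine Finset.sum_congr rfl fun l hl => ?_
    rw [Finset.mem_Icc] at hl
    rw [hs l (by omega), ← add_mul]
    have : w (n - l) + w l = 1 := by
      simp only [hw]
      split_ifs <;> first | omega | norm_num
    rw [this, one_mul]
  rw [h2, ← mul_assoc]
  norm_num
  symm
  rcases Nat.eq_zero_or_pos n with rfl | hn
  · simp
  refine (Finset.sum_congr rfl fun l hl => ?_).trans
    (Finset.sum_subset (f := fun l => w l * h l) (Finset.Icc_subset_Icc_right ?_) fun l _ hl => ?_)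
  · rw [Finset.mem_Icc] at hl
    simp only [hw]
    split_ifs <;> first | omega | ring
  · omega
  · rw [Finset.mem_Icc] at hl
    have : w l = 0 := by
      simp only [hw]
      grind
    rw [this, zero_mul]

/-- The two exponents add up to `2n`, and `|p| + |x| = n + (|p| - |xᶜ|)`, so the smaller one lies
below `n` by the absolute difference. Using `xᶜ` instead of `x` produces the `|l - j|` of the
explicit formula. -/
theorem min_subsystemDim (hd : 2 ≤ d) (p x : Finset (Fin n)) :
    min (subsystemDim d p x) (subsystemDim d pᶜ xᶜ) =
      d ^ (n - ((p.card : ℤ) - (xᶜ.card : ℤ)).natAbs) := by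
  have hp : p.card ≤ n := by simpa using p.card_le_univ
  have hx : x.card ≤ n := by simpa using x.card_le_univ
  simp only [subsystemDim, Finset.card_compl, Fintype.card_fin, ← pow_add]
  rcases le_total (p.card + x.card) (n - p.card + (n - x.card)) with h | h
  · rw [min_eq_left (Nat.pow_le_pow_right (by omega) h)]
    congr 1
    omega
  · rw [min_eq_right (Nat.pow_le_pow_right (by omega) h)]
    congr 1
    omega

/-- The explicit form of the bound for the entangling power. -/
theorem entanglingPowerBound_eq (hn : 2 ≤ n) (hd : 2 ≤ d) :
    entanglingPowerBound n d
      = 2 - 2 * (d : ℝ) ^ n / ((d : ℝ) + 1) ^ n *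
          ((2 : ℝ) ^ n - 1 / ((2 : ℝ) ^ (n - 1) - 1) *
            ∑ j ∈ Finset.range (n + 1), (n.choose j : ℝ) *
              ∑ l ∈ Finset.Icc 1 ⌊(n : ℝ) / 2⌋₊, (n.choose l : ℝ) *
                (((d : ℝ) ^ (n - ((l : ℤ) - (j : ℤ)).natAbs) - 1) /
                  ((d : ℝ) ^ (n - ((l : ℤ) - (j : ℤ)).natAbs) *
                    2 ^ (if (l : ℝ) = (n : ℝ) / 2 then 1 else 0)))) := by
  set f : ℕ → ℕ → ℝ := fun l j => ((d : ℝ) ^ (n - ((l : ℤ) - (j : ℤ)).natAbs) - 1) /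
    (d : ℝ) ^ (n - ((l : ℤ) - (j : ℤ)).natAbs) with hf
  set S : ℕ → ℝ := fun l => ∑ j ∈ Finset.range (n + 1), (n.choose j : ℝ) * f l j with hS
  have hfloor : ⌊(n : ℝ) / 2⌋₊ = n / 2 := by
    simpa using Nat.floor_div_eq_div (K := ℝ) n 2
  have hbound : ∀ p : Finset (Fin n), bipartitionBound d p =
      2 - 2 * ((d : ℝ) ^ n / ((d : ℝ) + 1) ^ n) * ((2 : ℝ) ^ n - S p.card) := by
    intro p
    unfold bipartitionBound
    rw [Finset.prod_const, Finset.card_univ, Fintype.card_fin, div_pow, hS]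
    congr 3
    simp only [min_subsystemDim hd, Nat.cast_pow]
    rw [← sum_card_eq_sum_choose (fun j => f p.card j)]
    -- Passing to complements makes `j` the cardinality of `xᶜ`.
    exact Fintype.sum_equiv (compl_involutive (α := Finset (Fin n))).toPerm _ _ fun x => rfl
  have hsymm : ∀ l, l ≤ n → S (n - l) = S l := by
    intro l hl
    simp only [hS]
    -- Replacing `j` by `n - j` along with `l` by `n - l` preserves both `|l - j|` and the binomial
    -- coefficient.
    rw [← Finset.sum_range_reflect]
    refine Finset.sum_congr rfl fun j hj => ?_
    rw [Finset.mem_range] at hj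
    have hj' : n + 1 - 1 - j = n - j := by omega
    rw [hj', Nat.choose_symm (by omega)]
    have : (((n - l : ℕ) : ℤ) - ((n - j : ℕ) : ℤ)).natAbs = ((l : ℤ) - (j : ℤ)).natAbs := by omega
    simp only [hf, this]
  have hhalf := sum_symm_half n (h := fun l => (n.choose l : ℝ) * S l) fun l hl => by
    simp only [hsymm l hl, Nat.choose_symm hl]
  have hrhs : ∑ j ∈ Finset.range (n + 1), (n.choose j : ℝ) *
      ∑ l ∈ Finset.Icc 1 ⌊(n : ℝ) / 2⌋₊, (n.choose l : ℝ) *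
        (((d : ℝ) ^ (n - ((l : ℤ) - (j : ℤ)).natAbs) - 1) /
          ((d : ℝ) ^ (n - ((l : ℤ) - (j : ℤ)).natAbs) *
            2 ^ (if (l : ℝ) = (n : ℝ) / 2 then 1 else 0))) =
      1 / 2 * ∑ p ∈ properParts n, S p.card := by
    rw [sum_properParts_card hn S, hhalf, hfloor]
    simp only [Finset.mul_sum]
    rw [Finset.sum_comm]
    refine Finset.sum_congr rfl fun l _ => ?_
    have hl : ((l : ℝ) = (n : ℝ) / 2) ↔ 2 * l = n := by
      rw [eq_div_iff two_ne_zero, mul_comm]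
      norm_cast
    simp only [hS, hf, hl, Finset.mul_sum, Finset.sum_mul]
    refine Finset.sum_congr rfl fun j _ => ?_
    split_ifs
    · rw [pow_one, ← div_div]
      ring
    · rw [pow_zero, mul_one]
      ring
  rw [hrhs]
  have hcard : ∑ _p ∈ properParts n, (1 : ℝ) = 2 * (2 ^ (n - 1) - 1) := by
    rw [sum_properParts hn]
    have h3 : (2 : ℝ) ^ n = 2 * 2 ^ (n - 1) := by
      rw [← pow_succ', Nat.sub_add_cancel (by omega)]
    simp [h3]
    ring
  have h2 := (two_pow_pred_sub_one_pos hn).ne'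
  have hsplit : ∀ p : Finset (Fin n), bipartitionBound d p =
      (2 - 2 * ((d : ℝ) ^ n / ((d : ℝ) + 1) ^ n) * (2 : ℝ) ^ n) * 1 +
        2 * ((d : ℝ) ^ n / ((d : ℝ) + 1) ^ n) * S p.card := fun p => by
    rw [hbound]
    ring
  unfold entanglingPowerBound bipartitionMean
  simp only [hsplit, Finset.sum_add_distrib, ← Finset.mul_sum, hcard]
  field_simp
  ring

end ExplicitBound

end EntanglingPower

end

open EntanglingPower in
theorem mainTheorem10 (n d : ℕ) (hn : 2 ≤ n) (hd : 2 ≤ d) :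
    -- mean over the unitary group
    (Integrable (fun U : Matrix.unitaryGroup (Index n d) ℂ =>
          entanglingPower (U : Matrix (Index n d) (Index n d) ℂ))
        (haarUnitary (Index n d) ℂ) ∧
      ∫ U : Matrix.unitaryGroup (Index n d) ℂ,
          entanglingPower (U : Matrix (Index n d) (Index n d) ℂ) ∂haarUnitary (Index n d) ℂ
        = ((2 : ℝ) ^ n * ((d : ℝ) ^ n + 1) - 2 * ((d : ℝ) + 1) ^ n) /
            (((2 : ℝ) ^ (n - 1) - 1) * ((d : ℝ) ^ n + 1))) ∧
    -- mean over the orthogonal group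
    (Integrable (fun O : Matrix.orthogonalGroup (Index n d) ℝ =>
          entanglingPower ((O : Matrix (Index n d) (Index n d) ℝ).map Complex.ofReal))
        (haarUnitary (Index n d) ℝ) ∧
      ∫ O : Matrix.orthogonalGroup (Index n d) ℝ,
          entanglingPower ((O : Matrix (Index n d) (Index n d) ℝ).map Complex.ofReal)
            ∂haarUnitary (Index n d) ℝ
        = (((2 : ℝ) ^ n * ((d : ℝ) ^ n + 1) - 2 * ((d : ℝ) + 1) ^ n) *
              ((d : ℝ) ^ n * ((d : ℝ) + 1) ^ n - (2 : ℝ) ^ n)) /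
            (((2 : ℝ) ^ (n - 1) - 1) * ((d : ℝ) ^ (2 * n) + (d : ℝ) ^ n - 2) *
              ((d : ℝ) + 1) ^ n)) ∧
    -- the upper bound
    (∀ U ∈ Matrix.unitaryGroup (Index n d) ℂ, entanglingPower U ≤ entanglingPowerBound n d) ∧
    entanglingPowerBound n d
      = 2 - 2 * (d : ℝ) ^ n / ((d : ℝ) + 1) ^ n *
          ((2 : ℝ) ^ n - 1 / ((2 : ℝ) ^ (n - 1) - 1) *
            ∑ j ∈ Finset.range (n + 1), (n.choose j : ℝ) *
              ∑ l ∈ Finset.Icc 1 ⌊(n : ℝ) / 2⌋₊, (n.choose l : ℝ) *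
                (((d : ℝ) ^ (n - ((l : ℤ) - (j : ℤ)).natAbs) - 1) /
                  ((d : ℝ) ^ (n - ((l : ℤ) - (j : ℤ)).natAbs) *
                    2 ^ (if (l : ℝ) = (n : ℝ) / 2 then 1 else 0)))) := by
  refine ⟨⟨?_, integral_entanglingPower_unitary hn hd⟩,
    ⟨?_, integral_entanglingPower_orthogonal hn hd⟩,
    fun U hU => entanglingPower_le hn hd hU, entanglingPowerBound_eq hn hd⟩
  · exact integrable_of_continuous ((continuous_entanglingPower hd).comp continuous_subtype_val)
  · exact integrable_of_continuous ((continuous_entanglingPower hd).comp continuous_orthogonal_map)
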